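/- Let $E$ be a countable set with the discrete metric (and all subsets measurable), and let $(X_k)_{k\in\mathbb Z}$ be an $E$-valued stationary Markov chain on a probability space $(\Omega,\mathbb P)$, with transition probabilities $\kappa(x,y)$ and one-time marginal (stationary measure) $\nu$, whose tail $\sigma$-field $\bigcap_{i\in\mathbb Z}\sigma(X_k:k\le i)$ is trivial, i.e. $\mathbb P$ takes only the values $0$ and $1$ on it. For all $x,y\in E$ let $\hat{\mathbb P}_{x,y}$ be a coupling, i.e. a law of pairs of paths $(u_k,v_k)_{k\ge 0}$, of the Markov chains with transition probabilities $\kappa$ started from $u_0=x$ and $v_0=y$, with expectation $\hat{\mathbb E}_{x,y}$, and let $T=\inf\{k\ge 0: u_j=v_j\ \forall j\ge k\}\in\{0,1,2,\dots\}\cup\{\infty\}$ be the coupling time. Fix $\eta>0$ and, for integers $p\ge 1$, put $$C_p=(2p-1)^{2p}\Big(\frac{\zeta(1+\eta)}{2}\Big)^p\sum_{x,y\in E}\nu(x)\kappa(x,y)\Big(\sum_{z\in E}\kappa(x,z)\,\hat{\mathbb E}_{y,z}\big[(T+1)^{1+\eta/2}\big]\Big)^{2p}\in(0,\infty],\qquad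 \zeta(s)=\sum_{m\ge1}m^{-s}.$$ Let $n\ge 1$ be an integer and let $A\subset E^n$ be a measurable set with $\mathbb P(A):=\mathbb P((X_1,\dots,X_n)\in A)>0$. For $\varepsilon>0$ let $$[A]_\varepsilon=\Big\{y\in E^n:\ \inf_{x\in A}\frac1n\#\{i: x_i\ne y_i\}\le\varepsilon\Big\}.$$ Then for every integer $p\ge 1$ and every real $\varepsilon>\dfrac{C_p^{1/2p}}{\sqrt n\,\mathbb P(A)^{1/2p}}$ (in particular there is such an $\varepsilon$ only if $C_p<\infty$), $$\mathbb P\big((X_1,\dots,X_n)\in[A]_\varepsilon\big)\ \ge\ 1-\frac1{n^p}\,\frac{1}{\left(\dfrac{\varepsilon}{C_p^{1/2p}}-\dfrac1{\sqrt n\,\mathbb P(A)^{1/2p}}\right)^{2p}}.$$ -/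

import Mathlib

open MeasureTheory ProbabilityTheory
open scoped ENNReal

namespace HammingConcentration

noncomputable section

/-- `pastSigma X i` is the sigma-field `F_{-∞}^i` generated by `X_k`, `k ≤ i`. -/
@[reducible] def pastSigma {Ω E : Type*} [MeasurableSpace E] (X : ℤ → Ω → E) (i : ℤ) : MeasurableSpace Ω :=
  ⨆ k : ℤ, ⨆ _ : k ≤ i, MeasurableSpace.comap (X k) inferInstance

/-- `(X_n)_{n ∈ ℤ}` is, under `P`, a two-sided stationary Markov chain with transition kernel `κ`
and one-time marginal `ν`. -/
structure IsStationaryMarkovChain {Ω E : Type*} [MeasurableSpace Ω] [MeasurableSpace E]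
    (κ : Kernel E E) (ν : Measure E) (P : Measure Ω) (X : ℤ → Ω → E) : Prop where
  measurable : ∀ i, Measurable (X i)
  stationary : P.map (fun ω (k : ℤ) => X (k + 1) ω) = P.map (fun ω (k : ℤ) => X k ω)
  marginal : P.map (X 0) = ν
  markov : ∀ (i : ℤ) (B : Set E), MeasurableSet B →
    P⟦X (i + 1) ⁻¹' B | pastSigma X i⟧ =ᵐ[P] fun ω => (κ (X i ω)).real B

/-- Triviality of the tail sigma-field `⋂ i, F_{-∞}^i` under `P`. -/
def IsTailTrivial {Ω E : Type*} [MeasurableSpace Ω] [MeasurableSpace E]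
    (P : Measure Ω) (X : ℤ → Ω → E) : Prop :=
  ∀ A : Set Ω, MeasurableSet[⨅ i : ℤ, pastSigma X i] A → P A = 0 ∨ P A = 1

open Classical in
/-- For a countable discrete `E`: `μ` is the law of the path `(u_0, u_1, …)` of the Markov chain
with transition kernel `κ` started from `u_0 = x`. -/
structure IsChainLaw {E : Type*} [MeasurableSpace E]
    (κ : Kernel E E) (x : E) (μ : Measure (ℕ → E)) : Prop where
  prob : IsProbabilityMeasure μ
  cylinder : ∀ (m : ℕ) (a : ℕ → E), μ {u | ∀ k ≤ m, u k = a k} =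
    if a 0 = x then ∏ k ∈ Finset.range m, κ (a k) {a (k + 1)} else 0

/-- `μ` is a coupling of the chain started from `x` and the chain started from `y`:
a law of a pair of paths `(u_k, v_k)_{k ≥ 0}` whose two marginals are the laws of these chains. -/
structure IsCoupling {E : Type*} [MeasurableSpace E]
    (κ : Kernel E E) (x y : E) (μ : Measure (ℕ → E × E)) : Prop where
  fst : IsChainLaw κ x (μ.map (fun w k => (w k).1))
  snd : IsChainLaw κ y (μ.map (fun w k => (w k).2))

/-- The coupling time `T = inf {k ≥ 0 : u_j = v_j for all j ≥ k}`, with `inf ∅ = ∞`. -/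
def couplingTime {E : Type*} (w : ℕ → E × E) : ℝ≥0∞ :=
  ⨅ (k : ℕ) (_ : ∀ j, k ≤ j → (w j).1 = (w j).2), (k : ℝ≥0∞)

/-- `ζ(s) = ∑_{n ≥ 1} n^{-s}`. -/
def zetaSum (s : ℝ) : ℝ≥0∞ := ∑' n : ℕ, ENNReal.ofReal (1 / ((n : ℝ) + 1) ^ s)

/-- The constant `C_p` (depending on `η > 0`), as an element of `[0, ∞]`:
`(2p-1)^{2p} (ζ(1+η)/2)^p
  ∑_{x,y} ν(x) κ(x,y) (∑_z κ(x,z) Ê_{y,z}[(T+1)^{1+η/2}])^{2p}`. -/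
def momentConst {E : Type*} [MeasurableSpace E] (κ : Kernel E E) (ν : Measure E)
    (Phat : E → E → Measure (ℕ → E × E)) (η : ℝ) (p : ℕ) : ℝ≥0∞ :=
  ENNReal.ofReal (2 * (p : ℝ) - 1) ^ (2 * p) * (zetaSum (1 + η) / 2) ^ p *
    ∑' x : E, ∑' y : E, ν {x} * κ x {y} *
      (∑' z : E, κ x {z} * ∫⁻ w, (couplingTime w + 1) ^ (1 + η / 2) ∂(Phat y z)) ^ (2 * p)

/-- The block `X_1^n = (X_1, …, X_n)`. -/
def block {Ω E : Type*} (X : ℤ → Ω → E) (n : ℕ) (ω : Ω) : Fin n → E :=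
  fun i => X ((i : ℤ) + 1) ω

open Classical in
/-- Normalized Hamming distance on `E^n`. -/
def normHamming {E : Type*} {n : ℕ} (x y : Fin n → E) : ℝ := (hammingDist x y : ℝ) / n

/-- The `ε`-neighbourhood `[A]_ε` for the normalized Hamming distance. -/
def hammingNhd {E : Type*} {n : ℕ} (A : Set (Fin n → E)) (ε : ℝ) : Set (Fin n → E) :=
  {y | (⨅ x : A, normHamming (x : Fin n → E) y) ≤ ε}

end

end HammingConcentration

/-! Let f be the normalized Hamming distance from the block to A. It is 1-Lipschitz and vanishes on
A, so it suffices to bound its 2p-th central moment by M = C_p / n^p. Markov's inequality on A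
itself gives (E f)^{2p} P(A) ≤ M, which bounds the mean, and a second use of Markov's inequality
bounds P(f > ε) (`real_gt_le_of_moment_le`).

The moment bound holds for every 1-Lipschitz g with |g| ≤ 1
(`IsStationaryMarkovChain.lintegral_sub_mean_pow_le`). It comes from the martingale M_i = E[g(X_1,
…, X_n) | F_{-∞}^i]. By the Markov property, M_{i+1} - M_i averages over z ~ κ(X_i, ·) the
difference between the means of g when the chain is at X_{i+1} and when it is at z at time i + 1.
Coupling the two chains bounds this by 1/n times the expected number of disagreements within the
block (`enorm_condMartingale_sub_le`). Cauchy–Schwarz with weights (m+1)^{-(1+η)} in the lag m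
separates a deterministic factor `varProxy`, whose sum over i is at most ζ(1+η)/n, from a factor
controlled by moments of the coupling time (`sq_sum_stepCoupling_le`). The increments are assembled
by a Rio-type inequality: up to the constant (2p-1)^2, squared L^{2p} norms of martingale
differences add (`lintegral_enorm_sub_pow_le`).

The martingale has to be followed back to -∞, since only there does it reach the mean: along a
subsequence it converges almost surely to a tail-measurable limit, which tail triviality makes
constant (`IsStationaryMarkovChain.exists_tendsto_condMartingale`). -/

namespace HammingConcentration

/-! ### A moment inequality for martingales -/

noncomputable section

/-- This is where the constant (2p-1)^2 comes from. For p = 1 there is equality. For p ≥ 2 and 2pv ≥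
1, already (1+v)^2 ≤ 1 + (2p-1)^2 v^2. For 2pv < 1, compare exp(2pv) ≤ 1 + 2pv + (2pv)^2 with
Bernoulli's inequality on the right. -/
lemma one_add_pow_two_mul_sub_le {p : ℕ} (hp : 1 ≤ p) {v : ℝ} (hv : 0 ≤ v) :
    (1 + v) ^ (2 * p) - 2 * p * v ≤ (1 + (2 * p - 1) ^ 2 * v ^ 2) ^ p := by
  have hp' : (1 : ℝ) ≤ p := by exact_mod_cast hp
  rcases hp.eq_or_lt with rfl | hp2
  · norm_num; nlinarith
  have hp2' : (2 : ℝ) ≤ p := by exact_mod_cast hp2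
  rcases le_or_gt 1 (2 * p * v) with h | h
  · have h1 : (1 + v) ^ (2 * p) ≤ (1 + (2 * p - 1) ^ 2 * v ^ 2) ^ p := by
      rw [pow_mul]
      refine pow_le_pow_left₀ (by positivity) ?_ p
      nlinarith [mul_le_mul_of_nonneg_left h hv, mul_nonneg hv hv,
        mul_nonneg (mul_nonneg hv (sub_nonneg.2 hp2')) (sub_nonneg.2 h), mul_nonneg hv (sub_nonneg.2 h)]
    nlinarith [mul_nonneg (zero_le_one.trans hp') hv]
  · have h0 : 0 ≤ 2 * p * v := by positivity
    have h1 : (1 + v) ^ (2 * p) ≤ Real.exp (2 * p * v) := by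
      have : Real.exp (2 * p * v) = Real.exp v ^ (2 * p) := by
        rw [← Real.exp_nat_mul]; push_cast; ring_nf
      rw [this]
      exact pow_le_pow_left₀ (by positivity) (by linarith [Real.add_one_le_exp v]) _
    have h2 := (abs_le.1 (Real.abs_exp_sub_one_sub_id_le
      (x := 2 * p * v) (by rw [abs_of_nonneg h0]; exact h.le))).2
    have h3 := one_add_mul_le_pow (a := (2 * (p : ℝ) - 1) ^ 2 * v ^ 2)
      (by nlinarith [sq_nonneg ((2 * (p : ℝ) - 1) * v)]) p
    have h4 : (2 * p * v) ^ 2 ≤ p * ((2 * (p : ℝ) - 1) ^ 2 * v ^ 2) := by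
      -- For p ≥ 2 this is 4p ≤ (2p-1)^2, which fails at p = 1; hence the separate case.
      have : (2 * (p : ℝ)) ^ 2 ≤ p * (2 * p - 1) ^ 2 := by nlinarith
      nlinarith [mul_le_mul_of_nonneg_right this (sq_nonneg v)]
    linarith

lemma add_pow_two_mul_sub_le {p : ℕ} (hp : 1 ≤ p) {m v : ℝ} (hm : 0 ≤ m) (hv : 0 ≤ v) :
    (m + v) ^ (2 * p) - 2 * p * m ^ (2 * p - 1) * v ≤
      (m ^ 2 + (2 * p - 1) ^ 2 * v ^ 2) ^ p := by
  have hp' : (1 : ℝ) ≤ p := by exact_mod_cast hp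
  rcases hm.eq_or_lt with rfl | hm
  · have : 2 * p - 1 ≠ 0 := by omega
    simp only [zero_add, zero_pow this, mul_zero, zero_mul, sub_zero, ne_eq, OfNat.ofNat_ne_zero,
      not_false_eq_true, zero_pow]
    rw [pow_mul]
    refine pow_le_pow_left₀ (by positivity) (le_mul_of_one_le_left (sq_nonneg v) ?_) p
    nlinarith
  · have h := one_add_pow_two_mul_sub_le hp (div_nonneg hv hm.le)
    have hm2 : 0 < m ^ (2 * p) := by positivity
    have h' := mul_le_mul_of_nonneg_left h hm2.le
    have e1 : m ^ (2 * p) * ((1 + v / m) ^ (2 * p) - 2 * p * (v / m)) =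
        (m + v) ^ (2 * p) - 2 * p * m ^ (2 * p - 1) * v := by
      rw [mul_sub, ← mul_pow, mul_add, mul_one, mul_div_cancel₀ _ hm.ne']
      congr 1
      obtain ⟨q, hq⟩ : ∃ q, 2 * p = q + 1 := ⟨2 * p - 1, by omega⟩
      rw [hq, Nat.add_sub_cancel, pow_succ]
      field_simp
    have e2 : m ^ (2 * p) * (1 + (2 * p - 1) ^ 2 * (v / m) ^ 2) ^ p =
        (m ^ 2 + (2 * p - 1) ^ 2 * v ^ 2) ^ p := by
      rw [pow_mul, ← mul_pow]
      congr 1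
      field_simp
    rwa [e1, e2] at h'

lemma sum_choose_Ico_two (q : ℕ) (hq : 1 ≤ q) (x y : ℝ) :
    (x + y) ^ q = x ^ q + q * x ^ (q - 1) * y +
      ∑ k ∈ Finset.Ico 2 (q + 1), x ^ (q - k) * y ^ k * (q.choose k : ℝ) := by
  rw [add_comm x y, add_pow, Finset.range_eq_Ico, Finset.sum_eq_sum_Ico_succ_bot (by omega),
    Finset.sum_eq_sum_Ico_succ_bot (by omega)]
  simp only [pow_zero, Nat.sub_zero, Nat.choose_zero_right, zero_add, pow_one, Nat.choose_one_right,
    Nat.cast_one, one_mul, mul_one]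
  rw [add_assoc]
  congr 1
  congr 1
  · ring
  · exact Finset.sum_congr rfl fun k _ => by ring

lemma add_pow_sub_le_sum_abs {q : ℕ} (hq : 1 ≤ q) (x y : ℝ) :
    (x + y) ^ q ≤ x ^ q + q * (x ^ (q - 1) * y) +
      ∑ k ∈ Finset.Ico 2 (q + 1), |x| ^ (q - k) * |y| ^ k * (q.choose k : ℝ) := by
  rw [sum_choose_Ico_two q hq, mul_assoc]
  refine add_le_add le_rfl (Finset.sum_le_sum fun k _ => ?_)
  rw [← abs_pow, ← abs_pow, ← abs_mul]
  exact mul_le_mul_of_nonneg_right (le_abs_self _) (Nat.cast_nonneg _)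

section

variable {Ω : Type*} [MeasurableSpace Ω] {P : Measure Ω}

/-- Hölder with exponents q/(q-k) and q/k; it controls the mixed terms in the binomial expansion of
(M + V)^q. -/
lemma lintegral_enorm_pow_mul_le {M V : Ω → ℝ} (hM : Measurable M) (hV : Measurable V)
    {q k : ℕ} (hk : k ≤ q) (hq : q ≠ 0) {m v : ℝ≥0∞}
    (hMm : ∫⁻ ω, ‖M ω‖ₑ ^ q ∂P ≤ m ^ q) (hVv : ∫⁻ ω, ‖V ω‖ₑ ^ q ∂P ≤ v ^ q) :
    ∫⁻ ω, ‖M ω‖ₑ ^ (q - k) * ‖V ω‖ₑ ^ k ∂P ≤ m ^ (q - k) * v ^ k := by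
  have hq0 : (q : ℝ) ≠ 0 := by exact_mod_cast hq
  have key : ∀ (x : ℝ≥0∞) (j : ℕ), (x ^ q) ^ ((j : ℝ) / q) = x ^ j := by
    intro x j
    rw [← ENNReal.rpow_natCast, ← ENNReal.rpow_mul, mul_div_cancel₀ _ hq0, ENNReal.rpow_natCast]
  have h := ENNReal.lintegral_mul_norm_pow_le (μ := P)
    (f := fun ω => ‖M ω‖ₑ ^ q) (g := fun ω => ‖V ω‖ₑ ^ q) (by fun_prop) (by fun_prop)
    (p := ((q - k : ℕ) : ℝ) / q) (q := (k : ℝ) / q) (by positivity) (by positivity)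
    (by rw [← add_div, Nat.cast_sub hk, sub_add_cancel, div_self hq0])
  simp only [key] at h
  refine h.trans ?_
  rw [← key m, ← key v]
  gcongr

lemma integrable_of_abs_le [IsFiniteMeasure P] {f : Ω → ℝ} (hf : Measurable f) {B : ℝ}
    (hB : ∀ ω, |f ω| ≤ B) : Integrable f P :=
  Integrable.of_bound hf.aestronglyMeasurable B (.of_forall hB)

lemma lintegral_enorm_pow_eq [IsFiniteMeasure P] {f : Ω → ℝ} (hf : Measurable f) {B : ℝ}
    (hB : ∀ ω, |f ω| ≤ B) (q : ℕ) :
    ∫⁻ ω, ‖f ω‖ₑ ^ (2 * q) ∂P = ENNReal.ofReal (∫ ω, f ω ^ (2 * q) ∂P) := by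
  rw [ofReal_integral_eq_lintegral_ofReal]
  · refine lintegral_congr fun ω => ?_
    rw [← enorm_pow, Real.enorm_of_nonneg (by rw [pow_mul]; positivity)]
  · refine integrable_of_abs_le (by fun_prop) (B := B ^ (2 * q)) fun ω => ?_
    rw [abs_pow]; exact pow_le_pow_left₀ (abs_nonneg _) (hB ω) _
  · exact .of_forall fun ω => by simp only [pow_mul]; positivity

/-- One step of a martingale moment inequality in the style of Rio. -/
lemma lintegral_enorm_add_pow_le [IsFiniteMeasure P] {M V : Ω → ℝ} (hM : Measurable M)
    (hV : Measurable V) {B : ℝ} (hMB : ∀ ω, |M ω| ≤ B) (hVB : ∀ ω, |V ω| ≤ B)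
    {p : ℕ} (hp : 1 ≤ p) (horth : ∫ ω, M ω ^ (2 * p - 1) * V ω ∂P = 0)
    {m v : ℝ} (hm : 0 ≤ m) (hv : 0 ≤ v)
    (hMm : ∫⁻ ω, ‖M ω‖ₑ ^ (2 * p) ∂P ≤ ENNReal.ofReal m ^ (2 * p))
    (hVv : ∫⁻ ω, ‖V ω‖ₑ ^ (2 * p) ∂P ≤ ENNReal.ofReal v ^ (2 * p)) :
    ∫⁻ ω, ‖M ω + V ω‖ₑ ^ (2 * p) ∂P ≤
      ENNReal.ofReal ((m ^ 2 + (2 * p - 1) ^ 2 * v ^ 2) ^ p) := by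
  rw [lintegral_enorm_pow_eq (f := fun ω => M ω + V ω) (hM.add hV) (B := B + B)
    (fun ω => (abs_add_le _ _).trans (add_le_add (hMB ω) (hVB ω)))]
  refine ENNReal.ofReal_le_ofReal ?_
  refine le_trans ?_ (add_pow_two_mul_sub_le hp hm hv)
  have hprod : ∀ a b : ℕ, ∀ ω, |(|M ω| ^ a * |V ω| ^ b)| ≤ B ^ a * B ^ b := by
    intro a b ω
    rw [abs_mul, abs_pow, abs_pow, abs_abs, abs_abs]
    have := abs_nonneg (M ω)
    have := (abs_nonneg _).trans (hMB ω)
    gcongr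
    · exact hMB ω
    · exact hVB ω
  have hint : ∀ a b : ℕ, Integrable (fun ω => |M ω| ^ a * |V ω| ^ b) P := fun a b =>
    integrable_of_abs_le (by fun_prop) (hprod a b)
  have hint' : ∀ a b : ℕ, Integrable (fun ω => M ω ^ a * V ω ^ b) P := fun a b =>
    integrable_of_abs_le (by fun_prop) fun ω => by
      have := hprod a b ω
      rwa [← abs_pow, ← abs_pow, ← abs_mul, abs_abs] at this
  -- Each binomial term is bounded by its scalar analogue. The linear term vanishes by
  -- orthogonality, so the expansion resums to (m+v)^{2p} without its linear term, which is what the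
  -- scalar inequality bounds.
  have hterm : ∀ k ≤ 2 * p, ∫ ω, |M ω| ^ (2 * p - k) * |V ω| ^ k ∂P ≤ m ^ (2 * p - k) * v ^ k := by
    intro k hk
    have h := lintegral_enorm_pow_mul_le hM hV hk (by omega) hMm hVv
    rw [← ENNReal.ofReal_le_ofReal_iff (by positivity), ofReal_integral_eq_lintegral_ofReal
      (hint _ _) (.of_forall fun ω => by positivity), ENNReal.ofReal_mul (by positivity),
      ENNReal.ofReal_pow hm, ENNReal.ofReal_pow hv]
    refine le_trans (le_of_eq (lintegral_congr fun ω => ?_)) h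
    rw [ENNReal.ofReal_mul (by positivity), ENNReal.ofReal_pow (abs_nonneg _),
      ENNReal.ofReal_pow (abs_nonneg _)]
    simp only [← Real.norm_eq_abs, ofReal_norm]
  have h2p : 1 ≤ 2 * p := by omega
  have hMint : Integrable (fun ω => M ω ^ (2 * p)) P := by simpa using hint' (2 * p) 0
  have hMVint : Integrable (fun ω => M ω ^ (2 * p - 1) * V ω) P := by
    simpa using hint' (2 * p - 1) 1
  have hM2 : ∫ ω, M ω ^ (2 * p) ∂P ≤ m ^ (2 * p) := by
    have := hterm 0 (by omega)
    simpa [← abs_pow, abs_of_nonneg, pow_mul, sq_nonneg, pow_nonneg] using this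
  have hsum : Integrable (fun ω => ∑ k ∈ Finset.Ico 2 (2 * p + 1),
      |M ω| ^ (2 * p - k) * |V ω| ^ k * ((2 * p).choose k : ℝ)) P :=
    integrable_finsetSum _ fun k _ => (hint _ _).mul_const _
  calc ∫ ω, (M ω + V ω) ^ (2 * p) ∂P
      ≤ ∫ ω, (M ω ^ (2 * p) + (2 * p : ℕ) * (M ω ^ (2 * p - 1) * V ω) +
          ∑ k ∈ Finset.Ico 2 (2 * p + 1),
            |M ω| ^ (2 * p - k) * |V ω| ^ k * ((2 * p).choose k : ℝ)) ∂P := by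
        refine integral_mono_of_nonneg (.of_forall fun ω => by simp only [Pi.zero_apply, pow_mul]; positivity)
          ((hMint.add (hMVint.const_mul _)).add hsum)
          (.of_forall fun ω => add_pow_sub_le_sum_abs h2p _ _)
    _ = ∫ ω, M ω ^ (2 * p) ∂P + ∑ k ∈ Finset.Ico 2 (2 * p + 1),
          (∫ ω, |M ω| ^ (2 * p - k) * |V ω| ^ k ∂P) * ((2 * p).choose k : ℝ) := by
        rw [integral_add (f := fun ω => M ω ^ (2 * p) + (2 * p : ℕ) * (M ω ^ (2 * p - 1) * V ω))
            (hMint.add (hMVint.const_mul _)) hsum,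
          integral_add hMint (hMVint.const_mul _), integral_const_mul, horth,
          integral_finsetSum _ fun k _ => (hint _ _).mul_const _]
        simp only [integral_mul_const, mul_zero, add_zero]
    _ ≤ m ^ (2 * p) + ∑ k ∈ Finset.Ico 2 (2 * p + 1),
          m ^ (2 * p - k) * v ^ k * ((2 * p).choose k : ℝ) := by
        gcongr with k hk
        exact hterm k (by have := Finset.mem_Ico.1 hk; omega)
    _ = (m + v) ^ (2 * p) - 2 * p * m ^ (2 * p - 1) * v := by
        rw [sum_choose_Ico_two _ h2p m v]; push_cast; ring

/-- A moment inequality of Burkholder–Rio type for sums of martingale differences. -/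
lemma lintegral_enorm_sub_pow_le [IsFiniteMeasure P] {f : ℕ → Ω → ℝ}
    (hf : ∀ j, Measurable (f j)) {B : ℝ} (hB : ∀ j ω, |f j ω| ≤ B) {p : ℕ} (hp : 1 ≤ p)
    (horth : ∀ j, ∫ ω, (f j ω - f 0 ω) ^ (2 * p - 1) * (f (j + 1) ω - f j ω) ∂P = 0)
    {s : ℕ → ℝ} (hs : ∀ j, 0 ≤ s j)
    (hV : ∀ j, ∫⁻ ω, ‖f (j + 1) ω - f j ω‖ₑ ^ (2 * p) ∂P ≤ ENNReal.ofReal (s j ^ p)) (J : ℕ) :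
    ∫⁻ ω, ‖f J ω - f 0 ω‖ₑ ^ (2 * p) ∂P ≤
      ENNReal.ofReal (((2 * p - 1) ^ 2 * ∑ j ∈ Finset.range J, s j) ^ p) := by
  induction J with
  | zero => simp [show p ≠ 0 by omega]
  | succ J ih =>
    have hS : 0 ≤ (2 * (p : ℝ) - 1) ^ 2 * ∑ j ∈ Finset.range J, s j :=
      mul_nonneg (sq_nonneg _) (Finset.sum_nonneg fun j _ => hs j)
    have hb : ∀ i j ω, |f i ω - f j ω| ≤ B + B := fun i j ω =>
      (abs_sub _ _).trans (add_le_add (hB i ω) (hB j ω))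
    have h := lintegral_enorm_add_pow_le (P := P) (M := fun ω => f J ω - f 0 ω)
      (V := fun ω => f (J + 1) ω - f J ω) ((hf J).sub (hf 0)) ((hf _).sub (hf _))
      (hb _ _) (hb _ _) hp (horth J) (Real.sqrt_nonneg
        ((2 * (p : ℝ) - 1) ^ 2 * ∑ j ∈ Finset.range J, s j)) (Real.sqrt_nonneg (s J))
      (by rwa [← ENNReal.ofReal_pow (Real.sqrt_nonneg _), pow_mul, Real.sq_sqrt hS])
      (by rw [← ENNReal.ofReal_pow (Real.sqrt_nonneg _), pow_mul, Real.sq_sqrt (hs J)]; exact hV J)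
    rw [Real.sq_sqrt hS, Real.sq_sqrt (hs J), ← mul_add, ← Finset.sum_range_succ] at h
    simpa using h

end

/-! ### Disagreement probabilities and moments of the coupling time -/

lemma sum_range_rpow_le {η : ℝ} (hη : 0 ≤ η) (t : ℕ) :
    ∑ m ∈ Finset.range t, ((m : ℝ≥0∞) + 1) ^ (1 + η) ≤ ((t : ℝ≥0∞) + 1) ^ (2 + η) / 2 := by
  -- Only the power η is bounded by its value at t; the remaining sum t(t+1)/2 of the linear factors
  -- yields the 1/2 that ends up in C_p.
  have h1 : ∀ m ∈ Finset.range t, ((m : ℝ≥0∞) + 1) ^ (1 + η) ≤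
      (((m + 1 : ℕ) : ℝ≥0∞)) * ((t : ℝ≥0∞) + 1) ^ η := by
    intro m hm
    rw [ENNReal.rpow_add_of_nonneg _ _ zero_le_one hη, ENNReal.rpow_one]
    push_cast
    gcongr
    exact (Finset.mem_range.1 hm).le
  refine (Finset.sum_le_sum h1).trans ?_
  rw [← Finset.sum_mul, ← Nat.cast_sum, ENNReal.rpow_add_of_nonneg _ _ zero_le_two hη,
    ENNReal.mul_div_right_comm]
  gcongr
  rw [ENNReal.le_div_iff_mul_le (by simp) (by simp)]
  have h2 : (∑ m ∈ Finset.range t, (m + 1)) * 2 ≤ (t + 1) ^ 2 := by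
    have := Finset.sum_range_id_mul_two (t + 1)
    rw [Finset.sum_range_succ'] at this
    simp only [add_zero, Nat.add_sub_cancel] at this
    rw [this]; nlinarith
  rw [ENNReal.rpow_two]
  exact_mod_cast h2

lemma sq_sum_mul_le_sum_sq_mul {ι : Type*} (s : Finset ι) (f g : ι → ℝ≥0∞) :
    (∑ i ∈ s, f i * g i) ^ 2 ≤ (∑ i ∈ s, f i ^ 2) * ∑ i ∈ s, g i ^ 2 := by
  have h := ENNReal.inner_le_Lp_mul_Lq s f g (p := 2) (q := 2) Real.HolderConjugate.two_two
  simp only [ENNReal.rpow_two] at h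
  refine (pow_le_pow_left' h 2).trans_eq ?_
  rw [mul_pow, ← ENNReal.rpow_natCast, ← ENNReal.rpow_natCast, ← ENNReal.rpow_mul,
    ← ENNReal.rpow_mul]
  norm_num

lemma lintegral_lintegral_mul_div_two {α : Type*} [MeasurableSpace α] {μ : Measure α}
    {S : α → ℝ≥0∞} (hS : Measurable S) :
    ∫⁻ w, ∫⁻ w', S w * S w' / 2 ∂μ ∂μ = (∫⁻ w, S w ∂μ) ^ 2 / 2 := by
  simp only [div_eq_mul_inv]
  have hin : ∀ w, ∫⁻ w', S w * S w' * 2⁻¹ ∂μ = S w * (∫⁻ w', S w' ∂μ) * 2⁻¹ := fun w => by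
    rw [lintegral_mul_const _ (hS.const_mul _), lintegral_const_mul _ hS]
  simp_rw [hin]
  rw [lintegral_mul_const _ (hS.mul_const _), lintegral_mul_const _ hS, sq]

lemma one_le_zetaSum (s : ℝ) : 1 ≤ zetaSum s := by
  refine le_trans ?_ (ENNReal.le_tsum 0)
  simp

section

variable {E : Type*}

lemma couplingTime_eq_top_or_nat (w : ℕ → E × E) :
    couplingTime w = ⊤ ∨ ∃ t : ℕ, couplingTime w = t ∧ ∀ j, t ≤ j → (w j).1 = (w j).2 := by
  classical
  by_cases h : ∃ k : ℕ, ∀ j, k ≤ j → (w j).1 = (w j).2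
  · refine Or.inr ⟨Nat.find h, le_antisymm (iInf₂_le _ (Nat.find_spec h)) ?_, Nat.find_spec h⟩
    exact le_iInf₂ fun k hk => by exact_mod_cast Nat.find_min' h hk
  · left
    simp only [couplingTime, iInf_eq_top]
    exact fun k hk => (h ⟨k, hk⟩).elim

/-- The indicator that a pair of paths disagrees at time `m`. -/
def disagree (m : ℕ) (w : ℕ → E × E) : ℝ≥0∞ := {w : ℕ → E × E | (w m).1 ≠ (w m).2}.indicator 1 w

lemma disagree_le_one (m : ℕ) (w : ℕ → E × E) : disagree m w ≤ 1 :=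
  Set.indicator_le_self' (fun _ _ => zero_le) w

lemma disagree_eq_zero {m : ℕ} {w : ℕ → E × E} (h : (w m).1 = (w m).2) : disagree m w = 0 := by
  simp [disagree, h]

lemma tsum_mul_disagree_le_of_eq {η : ℝ} (hη : 0 ≤ η) {w : ℕ → E × E} {t : ℕ}
    (ht : ∀ j, t ≤ j → (w j).1 = (w j).2) (b : ℕ → ℝ≥0∞) (hb : ∀ m, b m ≤ 1) :
    ∑' m : ℕ, ((m : ℝ≥0∞) + 1) ^ (1 + η) * (disagree m w * b m) ≤
      ((t : ℝ≥0∞) + 1) ^ (2 + η) / 2 := by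
  rw [tsum_eq_sum (s := Finset.range t)]
  · refine le_trans (Finset.sum_le_sum fun m _ => ?_) (sum_range_rpow_le hη t)
    exact mul_le_of_le_one_right' (mul_le_one' (disagree_le_one m w) (hb m))
  · intro m hm
    rw [disagree_eq_zero (ht m (by simpa using hm))]; simp

/-- Both paths disagree only before the smaller of the two coupling times, so the sum is at most
(min(T, T') + 1)^{2+η} / 2, and the power of the minimum splits evenly between T and T'. -/
lemma tsum_disagree_mul_disagree_le {η : ℝ} (hη : 0 ≤ η) (w w' : ℕ → E × E) :
    ∑' m : ℕ, ((m : ℝ≥0∞) + 1) ^ (1 + η) * (disagree m w * disagree m w') ≤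
      (couplingTime w + 1) ^ (1 + η / 2) * (couplingTime w' + 1) ^ (1 + η / 2) / 2 := by
  have hpos : 0 < 1 + η / 2 := by positivity
  have hone : ∀ w : ℕ → E × E, (couplingTime w + 1) ^ (1 + η / 2) ≠ 0 := fun w => by
    simp [ENNReal.rpow_eq_zero_iff, hpos, hpos.not_gt]
  rcases couplingTime_eq_top_or_nat w with h | ⟨t, h, ht⟩
  · simp [h, ENNReal.top_rpow_of_pos hpos, ENNReal.top_mul (hone w'), ENNReal.top_div]
  rcases couplingTime_eq_top_or_nat w' with h' | ⟨t', h', ht'⟩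
  · simp [h', ENNReal.top_rpow_of_pos hpos, ENNReal.mul_top (hone w), ENNReal.top_div]
  have hsplit : ∀ x : ℝ≥0∞, x ^ (2 + η) = x ^ (1 + η / 2) * x ^ (1 + η / 2) := fun x => by
    rw [← ENNReal.rpow_add_of_nonneg _ _ hpos.le hpos.le]; ring_nf
  rcases le_total t t' with hle | hle
  · refine (tsum_mul_disagree_le_of_eq hη ht _ fun m => disagree_le_one m w').trans ?_
    rw [hsplit, h, h']
    gcongr
  · simp_rw [mul_comm (disagree _ w)]
    refine (tsum_mul_disagree_le_of_eq hη ht' _ fun m => disagree_le_one m w).trans ?_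
    rw [hsplit, h, h']
    gcongr

variable [MeasurableSpace E] [Countable E] [DiscreteMeasurableSpace E]

lemma measurableSet_ne (m : ℕ) : MeasurableSet {w : ℕ → E × E | (w m).1 ≠ (w m).2} :=
  have h : Measurable fun w : ℕ → E × E => w m := measurable_pi_apply m
  h (MeasurableSet.of_discrete (s := {q : E × E | q.1 ≠ q.2}))

@[fun_prop]
lemma measurable_couplingTime : Measurable (couplingTime (E := E)) := by
  classical
  have h : couplingTime (E := E) = fun w => ⨅ k : ℕ,
      if w ∈ {w | ∀ j, k ≤ j → (w j).1 = (w j).2} then (k : ℝ≥0∞) else ⊤ := by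
    funext w
    simp only [couplingTime, Set.mem_ofPred_eq]
    exact iInf_congr fun k => iInf_eq_if _
  rw [h]
  refine Measurable.iInf fun k => Measurable.ite ?_ measurable_const measurable_const
  simp only [Set.ofPred_forall]
  refine MeasurableSet.iInter fun j => MeasurableSet.iInter fun _ => ?_
  have h : Measurable fun w : ℕ → E × E => w j := measurable_pi_apply j
  exact h (MeasurableSet.of_discrete (s := {q : E × E | q.1 = q.2}))

@[fun_prop]
lemma measurable_disagree (m : ℕ) : Measurable (disagree (E := E) m) :=
  measurable_one.indicator (measurableSet_ne m)

/-- A weighted `ℓ²` Minkowski inequality for the coupling time. -/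
lemma tsum_sq_lintegral_disagree_le {η : ℝ} (hη : 0 ≤ η) (μ : Measure (ℕ → E × E)) :
    ∑' m : ℕ, ((m : ℝ≥0∞) + 1) ^ (1 + η) * (∫⁻ w, disagree m w ∂μ) ^ 2 ≤
      (∫⁻ w, (couplingTime w + 1) ^ (1 + η / 2) ∂μ) ^ 2 / 2 := by
  have hT : Measurable fun w : ℕ → E × E => (couplingTime w + 1) ^ (1 + η / 2) := by fun_prop
  -- The squared integral is written as a double integral over two independent copies w, w', which
  -- reduces the claim to a pointwise one.
  calc ∑' m : ℕ, ((m : ℝ≥0∞) + 1) ^ (1 + η) * (∫⁻ w, disagree m w ∂μ) ^ 2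
      = ∫⁻ w, ∫⁻ w', ∑' m : ℕ, ((m : ℝ≥0∞) + 1) ^ (1 + η) *
          (disagree m w * disagree m w') ∂μ ∂μ := by
        have hin : ∀ w : ℕ → E × E, ∫⁻ w', ∑' m : ℕ, ((m : ℝ≥0∞) + 1) ^ (1 + η) *
            (disagree m w * disagree m w') ∂μ =
            ∑' m : ℕ, ((m : ℝ≥0∞) + 1) ^ (1 + η) * (disagree m w * ∫⁻ w', disagree m w' ∂μ) := by
          intro w
          rw [lintegral_tsum (by fun_prop)]
          refine tsum_congr fun m => ?_
          rw [lintegral_const_mul _ (by fun_prop), lintegral_const_mul _ (by fun_prop)]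
        simp_rw [hin]
        rw [lintegral_tsum (by fun_prop)]
        refine tsum_congr fun m => ?_
        rw [lintegral_const_mul _ (by fun_prop), lintegral_mul_const _ (by fun_prop), sq]
    _ ≤ ∫⁻ w, ∫⁻ w', (couplingTime w + 1) ^ (1 + η / 2) *
          (couplingTime w' + 1) ^ (1 + η / 2) / 2 ∂μ ∂μ :=
        lintegral_mono fun w => lintegral_mono fun w' => tsum_disagree_mul_disagree_le hη w w'
    _ = _ := lintegral_lintegral_mul_div_two hT

end

/-! ### Path laws are determined by cylinders; first-step decomposition -/

section

variable {E : Type*}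

/-- The set of paths agreeing with `a` up to time `m`. -/
def pathCylinder (m : ℕ) (a : ℕ → E) : Set (ℕ → E) := {u | ∀ k ≤ m, u k = a k}

lemma isPiSystem_pathCylinder :
    IsPiSystem {s : Set (ℕ → E) | ∃ m a, s = pathCylinder m a} := by
  rintro _ ⟨m, a, rfl⟩ _ ⟨m', a', rfl⟩ ⟨u, hu, hu'⟩
  refine ⟨max m m', u, Set.ext fun v => ⟨fun ⟨hv, hv'⟩ k hk => ?_, fun hv => ⟨fun k hk => ?_, fun k hk => ?_⟩⟩⟩
  · rcases le_max_iff.1 hk with hk | hk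
    · rw [hv k hk, hu k hk]
    · rw [hv' k hk, hu' k hk]
  · rw [hv k (hk.trans (le_max_left _ _)), hu k hk]
  · rw [hv k (hk.trans (le_max_right _ _)), hu' k hk]

variable [MeasurableSpace E]

/-- The path `(x, u_0, u_1, …)`. -/
def consPath (x : E) (u : ℕ → E) : ℕ → E
  | 0 => x
  | k + 1 => u k

@[fun_prop]
lemma measurable_consPath (x : E) : Measurable (consPath x) := by
  refine measurable_pi_iff.2 fun k => ?_
  cases k with
  | zero => exact measurable_const
  | succ k => exact measurable_pi_apply k

variable [Countable E] [DiscreteMeasurableSpace E]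

lemma generateFrom_pathCylinder :
    (MeasurableSpace.pi : MeasurableSpace (ℕ → E)) =
      MeasurableSpace.generateFrom {s | ∃ m a, s = pathCylinder m a} := by
  refine le_antisymm ?_ (MeasurableSpace.generateFrom_le ?_)
  · refine iSup_le fun k => ?_
    rw [← measurable_iff_comap_le]
    refine @measurable_to_countable' _ _ _ _ (_) _ fun y => ?_
    -- The union over prefixes of length k + 1 is countable; the value `y` beyond the prefix is an
    -- irrelevant filler.
    have : (fun u : ℕ → E => u k) ⁻¹' {y} = ⋃ a : {a : Fin (k + 1) → E // a (Fin.last k) = y},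
        pathCylinder k (fun j => if h : j < k + 1 then a.1 ⟨j, h⟩ else y) := by
      ext u
      simp only [Set.mem_preimage, Set.mem_singleton_iff, Set.mem_iUnion]
      constructor
      · intro h
        refine ⟨⟨fun j => u j, by simpa using h⟩, fun j hj => ?_⟩
        simp [Nat.lt_succ_of_le hj]
      · rintro ⟨⟨a, rfl⟩, hu⟩
        rw [hu k le_rfl]; simp [Fin.last]
    rw [this]
    exact MeasurableSet.iUnion fun a => MeasurableSpace.measurableSet_generateFrom ⟨_, _, rfl⟩
  · rintro _ ⟨m, a, rfl⟩
    simp only [pathCylinder, Set.ofPred_forall]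
    refine MeasurableSet.iInter fun k => MeasurableSet.iInter fun _ => ?_
    have h : Measurable fun u : ℕ → E => u k := measurable_pi_apply k
    exact h (measurableSet_singleton (a k))

variable {κ : Kernel E E}

/-- Allows the marginals of couplings for different pairs of starting points to be identified with
one family `Q`. -/
lemma IsChainLaw.unique {x : E} {μ μ' : Measure (ℕ → E)} (h : IsChainLaw κ x μ)
    (h' : IsChainLaw κ x μ') : μ = μ' := by
  have := h.prob
  have := h'.prob
  refine ext_of_generate_finite _ generateFrom_pathCylinder isPiSystem_pathCylinder ?_ (by simp)
  rintro _ ⟨m, a, rfl⟩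
  exact (h.cylinder m a).trans (h'.cylinder m a).symm

variable [IsMarkovKernel κ] {Q : E → Measure (ℕ → E)}

lemma isChainLaw_bind_consPath (hQ : ∀ x, IsChainLaw κ x (Q x)) (x : E) :
    IsChainLaw κ x ((κ x).bind fun z => (Q z).map (consPath x)) := by
  classical
  have hprob := fun z => (hQ z).prob
  have hm : AEMeasurable (fun z => (Q z).map (consPath x)) (κ x) := Measurable.of_discrete.aemeasurable
  have hcyl : ∀ m (a : ℕ → E), MeasurableSet (pathCylinder m a) := fun m a => by
    rw [generateFrom_pathCylinder]
    exact MeasurableSpace.measurableSet_generateFrom ⟨_, _, rfl⟩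
  refine ⟨⟨?_⟩, fun m a => ?_⟩
  · rw [Measure.bind_apply .univ hm]
    simp [Measure.map_apply (measurable_consPath x) .univ]
  change ((κ x).bind fun z => (Q z).map (consPath x)) (pathCylinder m a) = _
  rw [Measure.bind_apply (hcyl m a) hm]
  simp_rw [Measure.map_apply (measurable_consPath x) (hcyl m a)]
  split_ifs with h0
  · cases m with
    | zero =>
      have : consPath x ⁻¹' pathCylinder 0 a = Set.univ := by
        ext u
        simp [pathCylinder, consPath, h0]
      simp [this]
    | succ m =>
      have : consPath x ⁻¹' pathCylinder (m + 1) a = pathCylinder m fun k => a (k + 1) := by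
        ext u
        refine ⟨fun h k hk => h (k + 1) (by omega), fun h k hk => ?_⟩
        cases k with
        | zero => exact h0.symm
        | succ k => exact h k (by omega)
      rw [this]
      have hz : ∀ z, Q z (pathCylinder m fun k => a (k + 1)) = _ := fun z =>
        (hQ z).cylinder m fun k => a (k + 1)
      simp_rw [hz]
      rw [lintegral_countable', tsum_eq_single (a (0 + 1))]
      · rw [if_pos rfl, Finset.prod_range_succ', h0]
      · intro z hz
        rw [if_neg (Ne.symm hz), zero_mul]
  · have : consPath x ⁻¹' pathCylinder m a = ∅ := by
      ext u
      simp only [Set.mem_preimage, Set.mem_empty_iff_false, iff_false]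
      exact fun h => h0 (h 0 (Nat.zero_le _)).symm
    simp [this]

lemma IsChainLaw.eq_bind (hQ : ∀ x, IsChainLaw κ x (Q x)) (x : E) :
    Q x = (κ x).bind fun z => (Q z).map (consPath x) :=
  (hQ x).unique (isChainLaw_bind_consPath hQ x)

end

/-! ### Conditional means of a function of the block -/

section

variable {E : Type*}

/-- The block whose entries before time `i` are those of `b` and whose entries from time `i` on
are those of the path `u` started at time `i`; the entry `k : Fin n` sits at time `k + 1`. -/
def spliceBlock {n : ℕ} (i : ℤ) (b : Fin n → E) (u : ℕ → E) : Fin n → E :=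
  fun k => if (k : ℤ) + 1 < i then b k else u ((k : ℤ) + 1 - i).toNat

lemma spliceBlock_of_lt {n : ℕ} {i : ℤ} (hi : (n : ℤ) < i) (b : Fin n → E) (u : ℕ → E) :
    spliceBlock i b u = b := by
  funext k
  have := k.2
  exact if_pos (by omega)

lemma spliceBlock_consPath {n : ℕ} {i : ℤ} {b : Fin n → E} {y : E}
    (hb : ∀ k : Fin n, (k : ℤ) + 1 = i → b k = y) (u : ℕ → E) :
    spliceBlock i b (consPath y u) = spliceBlock (i + 1) b u := by
  funext k
  simp only [spliceBlock]
  rcases lt_trichotomy ((k : ℤ) + 1) i with h | h | h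
  · rw [if_pos h, if_pos (by omega)]
  · rw [if_neg (by omega), if_pos (by omega), hb k h]
    simp [h, consPath]
  · rw [if_neg (by omega), if_neg (by omega)]
    have : ((k : ℤ) + 1 - i).toNat = ((k : ℤ) + 1 - (i + 1)).toNat + 1 := by omega
    rw [this, consPath]

lemma spliceBlock_congr {n : ℕ} {i : ℤ} {b b' : Fin n → E}
    (h : ∀ k : Fin n, (k : ℤ) + 1 < i → b k = b' k) (u : ℕ → E) :
    spliceBlock i b u = spliceBlock i b' u := by
  funext k
  simp only [spliceBlock]
  split_ifs with hk
  · exact h k hk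
  · rfl

variable [MeasurableSpace E]

@[fun_prop]
lemma measurable_spliceBlock {n : ℕ} (i : ℤ) (b : Fin n → E) :
    Measurable (spliceBlock i b) := by
  refine measurable_pi_iff.2 fun k => ?_
  simp only [spliceBlock]
  split_ifs
  · exact measurable_const
  · exact measurable_pi_apply _

/-- The mean of `g (X_1, …, X_n)` given that `X_i = y` and that the entries before time `i`
are those of `b`. -/
def condMean {n : ℕ} (Q : E → Measure (ℕ → E)) (g : (Fin n → E) → ℝ) (i : ℤ) (b : Fin n → E)
    (y : E) : ℝ := ∫ u, g (spliceBlock i b u) ∂Q y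

variable {n : ℕ} {g : (Fin n → E) → ℝ} {Q : E → Measure (ℕ → E)}

lemma abs_condMean_le (hQ : ∀ x, IsProbabilityMeasure (Q x)) (hg : ∀ b, |g b| ≤ 1) (i : ℤ)
    (b : Fin n → E) (y : E) : |condMean Q g i b y| ≤ 1 := by
  have h := norm_integral_le_of_norm_le_const (μ := Q y) (f := fun u => g (spliceBlock i b u))
    (.of_forall fun u => hg _)
  simpa [condMean] using h

lemma condMean_of_lt (hQ : ∀ x, IsProbabilityMeasure (Q x)) {i : ℤ} (hi : (n : ℤ) < i)
    (b : Fin n → E) (y : E) : condMean Q g i b y = g b := by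
  simp [condMean, spliceBlock_of_lt hi]

lemma condMean_congr {i : ℤ} {b b' : Fin n → E} (h : ∀ k : Fin n, (k : ℤ) + 1 < i → b k = b' k)
    (y : E) : condMean Q g i b y = condMean Q g i b' y := by
  simp only [condMean, spliceBlock_congr h]

variable [Countable E] [DiscreteMeasurableSpace E]

lemma integrable_comp_spliceBlock (μ : Measure (ℕ → E)) [IsFiniteMeasure μ]
    (hg : ∀ b, |g b| ≤ 1) (i : ℤ) (b : Fin n → E) :
    Integrable (fun u => g (spliceBlock i b u)) μ :=
  integrable_of_abs_le ((Measurable.of_discrete (f := g)).comp (measurable_spliceBlock i b))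
    fun _ => hg _

variable {κ : Kernel E E}

/-- First-step decomposition: the path from y is y followed by a path from a κ(y, ·)-distributed
point. The condition `hb` makes the entry at time i, if it lies in the block, equal to y on both
sides. -/
lemma condMean_eq_integral [IsMarkovKernel κ] (hQ : ∀ x, IsChainLaw κ x (Q x)) (hg : ∀ b, |g b| ≤ 1) {i : ℤ}
    {b : Fin n → E} {y : E} (hb : ∀ k : Fin n, (k : ℤ) + 1 = i → b k = y) :
    condMean Q g i b y = ∫ z, condMean Q g (i + 1) b z ∂κ y := by
  have hprob := fun x => (hQ x).prob
  have hgm : Measurable g := .of_discrete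
  let K : Kernel E (ℕ → E) := ⟨fun z => (Q z).map (consPath y), .of_discrete⟩
  have hK : Q y = (K ∘ₖ κ) y := by
    rw [Kernel.comp_apply, IsChainLaw.eq_bind hQ y]; rfl
  have hint := integrable_comp_spliceBlock (Q y) hg i b
  rw [condMean, hK, Kernel.integral_comp (hK ▸ hint)]
  refine integral_congr_ae (.of_forall fun z => ?_)
  change ∫ u, g (spliceBlock i b u) ∂((Q z).map (consPath y)) = _
  have hsm : Measurable fun u => g (spliceBlock i b u) := hgm.comp (measurable_spliceBlock i b)
  rw [integral_map (by fun_prop) hsm.aestronglyMeasurable]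
  simp only [spliceBlock_consPath hb, condMean]

open Classical in
-- Realize both means under the coupling of y and z. The two spliced blocks share their entries
-- before time i, so their Hamming distance counts only disagreements of the coupled paths at later
-- or equal times.
lemma enorm_condMean_sub_le {Phat : E → E → Measure (ℕ → E × E)}
    (hPhat : ∀ x y, IsCoupling κ x y (Phat x y)) (hQ : ∀ x, IsChainLaw κ x (Q x))
    (hg : ∀ b, |g b| ≤ 1) (hlip : ∀ a b, |g a - g b| ≤ normHamming a b) (i : ℤ) (b : Fin n → E)
    (y z : E) :
    ‖condMean Q g i b y - condMean Q g i b z‖ₑ ≤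
      ∑ k ∈ Finset.univ.filter (fun k : Fin n => i ≤ (k : ℤ) + 1),
        (n : ℝ≥0∞)⁻¹ * ∫⁻ w, disagree ((k : ℤ) + 1 - i).toNat w ∂Phat y z := by
  have hgm : Measurable g := .of_discrete
  have h1 : Q y = (Phat y z).map (fun w k => (w k).1) := (hQ y).unique (hPhat y z).fst
  have h2 : Q z = (Phat y z).map (fun w k => (w k).2) := (hQ z).unique (hPhat y z).snd
  have hm1 : Measurable fun (w : ℕ → E × E) k => (w k).1 := by fun_prop
  have hm2 : Measurable fun (w : ℕ → E × E) k => (w k).2 := by fun_prop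
  have hfin : IsFiniteMeasure (Phat y z) := by
    have := (hQ y).prob
    rw [h1] at this
    refine ⟨?_⟩
    have h := measure_lt_top ((Phat y z).map (fun w k => (w k).1)) Set.univ
    rwa [Measure.map_apply hm1 .univ, Set.preimage_univ] at h
  have hsm : Measurable fun u => g (spliceBlock i b u) := hgm.comp (measurable_spliceBlock i b)
  rw [condMean, condMean, h1, h2, integral_map hm1.aemeasurable hsm.aestronglyMeasurable,
    integral_map hm2.aemeasurable hsm.aestronglyMeasurable]
  have hi1 : Integrable (fun w => g (spliceBlock i b fun k => (w k).1)) (Phat y z) :=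
    integrable_of_abs_le (hsm.comp hm1) fun _ => hg _
  have hi2 : Integrable (fun w => g (spliceBlock i b fun k => (w k).2)) (Phat y z) :=
    integrable_of_abs_le (hsm.comp hm2) fun _ => hg _
  rw [← integral_sub hi1 hi2]
  refine (enorm_integral_le_lintegral_enorm _).trans ?_
  simp_rw [← lintegral_const_mul _ (measurable_disagree _)]
  rw [← lintegral_finsetSum _ fun k _ => by fun_prop]
  refine lintegral_mono fun w => ?_
  set a := spliceBlock i b fun k => (w k).1
  set a' := spliceBlock i b fun k => (w k).2
  rw [← Finset.mul_sum, ← ENNReal.div_eq_inv_mul]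
  calc ‖g a - g a'‖ₑ ≤ ENNReal.ofReal (normHamming a a') := by
        rw [← ofReal_norm]; exact ENNReal.ofReal_le_ofReal (hlip a a')
    _ ≤ (hammingDist a a' : ℝ≥0∞) / n := by
        rw [normHamming]
        rcases n.eq_zero_or_pos with h0 | h0
        · simp [h0]
        · rw [ENNReal.ofReal_div_of_pos (by exact_mod_cast h0)]; simp
    _ ≤ _ := by
        gcongr
        rw [hammingDist, Finset.card_eq_sum_ones, Nat.cast_sum]
        refine (Finset.sum_le_sum fun k hk => ?_).trans (Finset.sum_le_sum_of_subset ?_)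
        · have hk' : a k ≠ a' k := (Finset.mem_filter.1 hk).2
          have hik : ¬ (k : ℤ) + 1 < i := fun h => hk' (by simp [a, a', spliceBlock, h])
          have : (w ((k : ℤ) + 1 - i).toNat).1 ≠ (w ((k : ℤ) + 1 - i).toNat).2 := fun h =>
            hk' (by simp [a, a', spliceBlock, hik, h])
          simp [disagree, this]
        · intro k hk
          have hk' : a k ≠ a' k := (Finset.mem_filter.1 hk).2
          have hik : ¬ (k : ℤ) + 1 < i := fun h => hk' (by simp [a, a', spliceBlock, h])
          exact Finset.mem_filter.2 ⟨Finset.mem_univ _, by omega⟩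

end

/-! ### The one-step Markov property and the martingale -/

section

variable {Ω E : Type*} [MeasurableSpace E] {X : ℤ → Ω → E}

lemma pastSigma_mono {i j : ℤ} (hij : i ≤ j) : pastSigma X i ≤ pastSigma X j :=
  iSup₂_le fun k hk => le_iSup₂ (f := fun k (_ : k ≤ j) =>
    MeasurableSpace.comap (X k) inferInstance) k (hk.trans hij)

lemma measurable_pastSigma {i j : ℤ} (hij : i ≤ j) : Measurable[pastSigma X j] (X i) :=
  measurable_iff_comap_le.2 (le_iSup₂ (f := fun k (_ : k ≤ j) =>
    MeasurableSpace.comap (X k) inferInstance) i hij)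

lemma measurable_condMean_block [Countable E] [DiscreteMeasurableSpace E]
    {_ : MeasurableSpace Ω} {n : ℕ} {g : (Fin n → E) → ℝ} {Q : E → Measure (ℕ → E)} {i : ℤ}
    (hX : ∀ j < i, Measurable (X j)) {Y : Ω → E} (hY : Measurable Y) :
    Measurable fun ω => condMean Q g i (block X n ω) (Y ω) := by
  -- Entries from time i on do not affect `condMean`; overwriting them by `Y` leaves only variables
  -- known to be measurable, which matters when the σ-algebra is the past.
  have h : (fun ω => condMean Q g i (block X n ω) (Y ω)) =
      (fun q : (Fin n → E) × E => condMean Q g i q.1 q.2) ∘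
        fun ω => (fun k : Fin n => if (k : ℤ) + 1 < i then X ((k : ℤ) + 1) ω else Y ω, Y ω) := by
    funext ω
    exact condMean_congr (fun k hk => by simp [block, hk]) _
  rw [h]
  refine Measurable.of_discrete.comp ((measurable_pi_iff.2 fun k => ?_).prodMk hY)
  split_ifs with hk
  · exact hX _ hk
  · exact hY

lemma measurable_pastSigma_condMean [Countable E] [DiscreteMeasurableSpace E] {n : ℕ}
    {g : (Fin n → E) → ℝ} {Q : E → Measure (ℕ → E)} (i : ℤ) (z : E) :
    Measurable[pastSigma X i] fun ω => condMean Q g (i + 1) (block X n ω) z :=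
  measurable_condMean_block (fun _ hj => measurable_pastSigma (by omega)) measurable_const

variable [MeasurableSpace Ω] {P : Measure Ω} {κ : Kernel E E}
  {ν : Measure E}

lemma IsStationaryMarkovChain.pastSigma_le (hX : IsStationaryMarkovChain κ ν P X) (i : ℤ) :
    pastSigma X i ≤ ‹MeasurableSpace Ω› :=
  iSup₂_le fun k _ => measurable_iff_comap_le.1 (hX.measurable k)

lemma IsStationaryMarkovChain.map_eq (hX : IsStationaryMarkovChain κ ν P X) (i : ℤ) :
    P.map (X i) = ν := by
  have hstep : ∀ j : ℤ, P.map (X (j + 1)) = P.map (X j) := fun j => by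
    have h := congrArg (Measure.map fun b : ℤ → E => b j) hX.stationary
    rwa [Measure.map_map (measurable_pi_apply j) (measurable_pi_iff.2 fun k => hX.measurable _),
      Measure.map_map (measurable_pi_apply j) (measurable_pi_iff.2 fun k => hX.measurable _)] at h
  rw [← hX.marginal]
  induction i with
  | zero => rfl
  | succ i ih => rw [hstep, ih]
  | pred i ih => rw [← ih, ← hstep]; simp

variable [IsProbabilityMeasure P] [Countable E] [DiscreteMeasurableSpace E] [IsMarkovKernel κ]

/-- The one-step Markov property for functions of the past and of the next state. -/
lemma IsStationaryMarkovChain.integral_next (hX : IsStationaryMarkovChain κ ν P X) {i : ℤ}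
    {F : Ω → E → ℝ} (hF : ∀ z, Measurable[pastSigma X i] fun ω => F ω z) {B : ℝ}
    (hB : ∀ ω z, |F ω z| ≤ B) :
    ∫ ω, F ω (X (i + 1) ω) ∂P = ∫ ω, ∫ z, F ω z ∂κ (X i ω) ∂P := by
  classical
  have hm := hX.pastSigma_le i
  have hFm : ∀ z, Measurable fun ω => F ω z := fun z => (hF z).mono hm le_rfl
  have hpre : ∀ z, MeasurableSet (X (i + 1) ⁻¹' {z}) := fun z =>
    hX.measurable _ (measurableSet_singleton z)
  have hκm : ∀ z, Measurable fun ω => (κ (X i ω)).real {z} := fun z =>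
    (Measurable.of_discrete (f := fun x => (κ x).real {z})).comp (hX.measurable i)
  have hκ1 : ∀ z ω, |(κ (X i ω)).real {z}| ≤ 1 := fun z ω => by
    rw [abs_of_nonneg measureReal_nonneg]; exact measureReal_le_one
  have hmul : ∀ {φ : Ω → ℝ} z, (∀ ω, |φ ω| ≤ 1) → ∀ ω, |F ω z * φ ω| ≤ B := fun {φ} z hφ ω => by
    rw [abs_mul]
    exact (mul_le_of_le_one_right (abs_nonneg _) (hφ ω)).trans (hB ω z)
  let φ : E → Ω → ℝ := fun z => (X (i + 1) ⁻¹' {z}).indicator fun _ => 1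
  have hφm : ∀ z, Measurable (φ z) := fun z => measurable_const.indicator (hpre z)
  have hφ1 : ∀ z ω, |φ z ω| ≤ 1 := fun z ω => by
    simp only [φ, Set.indicator]; split_ifs <;> simp
  have hFφ : ∀ z, Integrable (fun ω => F ω z * φ z ω) P := fun z =>
    integrable_of_abs_le ((hFm z).mul (hφm z)) (hmul z (hφ1 z))
  have hFκ : ∀ z, Integrable (fun ω => F ω z * (κ (X i ω)).real {z}) P := fun z =>
    integrable_of_abs_le ((hFm z).mul (hκm z)) (hmul z (hκ1 z))
  -- For a fixed next state z, the past-measurable factor is pulled out of the conditional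
  -- expectation; summing over the countably many z by dominated convergence then gives the claim.
  have hterm : ∀ z, ∫ ω, F ω z * φ z ω ∂P = ∫ ω, F ω z * (κ (X i ω)).real {z} ∂P := by
    intro z
    have h1 := condExp_mul_of_stronglyMeasurable_left (m := pastSigma X i) (μ := P)
      (f := fun ω => F ω z) (g := φ z) (hF z).stronglyMeasurable (hFφ z)
      (integrable_of_abs_le (hφm z) (hφ1 z))
    have h2 : P[φ z | pastSigma X i] =ᵐ[P] fun ω => (κ (X i ω)).real {z} :=
      hX.markov i {z} (measurableSet_singleton z)
    rw [← integral_condExp hm (f := fun ω => F ω z * φ z ω)]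
    refine integral_congr_ae (h1.trans ?_)
    filter_upwards [h2] with ω hω
    simp [hω]
  have hB0 : 0 ≤ B ∨ IsEmpty Ω := by
    by_cases h : Nonempty Ω
    · obtain ⟨ω⟩ := h
      exact Or.inl ((abs_nonneg _).trans (hB ω (X 0 ω)))
    · exact Or.inr (not_nonempty_iff.1 h)
  rcases hB0 with hB0 | hΩ
  swap
  · simp [integral, Measure.eq_zero_of_isEmpty P]
  have hφsum : ∀ ω, HasSum (fun z => F ω z * φ z ω) (F ω (X (i + 1) ω)) := fun ω => by
    have := hasSum_single (f := fun z => F ω z * φ z ω) (X (i + 1) ω) (fun z hz => by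
      simp [φ, Ne.symm hz])
    simpa [φ] using this
  have hκ : ∀ x, HasSum (fun z => (κ x).real {z}) 1 := fun x => by
    have h1 : ∑' z, κ x {z} = 1 := by
      simpa using (lintegral_countable' (μ := κ x) (fun _ => 1)).symm
    have h2 : Summable fun z => (κ x).real {z} := ENNReal.summable_toReal (by simp [h1])
    have h3 := h2.hasSum
    rwa [show ∑' z, (κ x).real {z} = (∑' z, κ x {z}).toReal from
      (ENNReal.tsum_toReal_eq fun z => measure_ne_top _ _).symm, h1, ENNReal.toReal_one] at h3
  have hκsum : ∀ ω, HasSum (fun z => F ω z * (κ (X i ω)).real {z}) (∫ z, F ω z ∂κ (X i ω)) := by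
    intro ω
    rw [integral_countable (integrable_of_abs_le .of_discrete (hB ω))]
    simp only [smul_eq_mul, mul_comm (F ω _)]
    refine Summable.hasSum (Summable.of_norm_bounded ((hκ (X i ω)).summable.mul_left B) fun z => ?_)
    rw [mul_comm, norm_mul, Real.norm_of_nonneg (r := (κ (X i ω)).real {z}) measureReal_nonneg]
    exact mul_le_mul_of_nonneg_right (hB ω z) measureReal_nonneg
  have hφone : ∀ ω, HasSum (fun z => B * φ z ω) B := fun ω => by
    have := hasSum_single (f := fun z => B * φ z ω) (X (i + 1) ω) (fun z hz => by
      simp [φ, Ne.symm hz])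
    simpa [φ] using this
  have hκone : ∀ ω, HasSum (fun z => B * (κ (X i ω)).real {z}) B := fun ω => by
    simpa using (hκ (X i ω)).mul_left B
  have h1 := hasSum_integral_of_dominated_convergence (μ := P) (F := fun z ω => F ω z * φ z ω)
    (f := fun ω => F ω (X (i + 1) ω)) (fun z ω => B * φ z ω)
    (fun z => (hFφ z).aestronglyMeasurable)
    (fun z => .of_forall fun ω => by
      rw [norm_mul, Real.norm_of_nonneg (r := φ z ω) (Set.indicator_nonneg (fun _ _ => zero_le_one) ω)]
      exact mul_le_mul_of_nonneg_right (hB ω z) (Set.indicator_nonneg (fun _ _ => zero_le_one) ω))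
    (.of_forall fun ω => (hφone ω).summable)
    (by simp_rw [(hφone _).tsum_eq]; exact integrable_const B)
    (.of_forall hφsum)
  have h2 := hasSum_integral_of_dominated_convergence (μ := P)
    (F := fun z ω => F ω z * (κ (X i ω)).real {z})
    (f := fun ω => ∫ z, F ω z ∂κ (X i ω)) (fun z ω => B * (κ (X i ω)).real {z})
    (fun z => (hFκ z).aestronglyMeasurable)
    (fun z => .of_forall fun ω => by
      rw [norm_mul, Real.norm_of_nonneg measureReal_nonneg]
      exact mul_le_mul_of_nonneg_right (hB ω z) measureReal_nonneg)
    (.of_forall fun ω => (hκone ω).summable)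
    (by simp_rw [(hκone _).tsum_eq]; exact integrable_const B)
    (.of_forall hκsum)
  simp_rw [hterm] at h1
  exact h1.unique h2

lemma IsStationaryMarkovChain.measure_pair (hX : IsStationaryMarkovChain κ ν P X) (i : ℤ)
    (x y : E) : P.map (fun ω => (X i ω, X (i + 1) ω)) {(x, y)} = ν {x} * κ x {y} := by
  classical
  have hxm : MeasurableSet[pastSigma X i] (X i ⁻¹' {x}) :=
    measurable_pastSigma le_rfl (measurableSet_singleton x)
  have h := hX.integral_next (i := i)
    (F := fun ω z => (X i ⁻¹' {x}).indicator (fun _ => if z = y then (1 : ℝ) else 0) ω) (B := 1)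
    (fun z => measurable_const.indicator hxm)
    (fun ω z => by simp only [Set.indicator]; split_ifs <;> simp)
  have hmx := hX.measurable i (measurableSet_singleton x)
  have hmy := hX.measurable (i + 1) (measurableSet_singleton y)
  have e1 : ∀ ω, (X i ⁻¹' {x}).indicator (fun _ => if X (i + 1) ω = y then (1 : ℝ) else 0) ω =
      (X i ⁻¹' {x} ∩ X (i + 1) ⁻¹' {y}).indicator 1 ω := fun ω => by
    simp only [Set.indicator, Set.mem_preimage, Set.mem_singleton_iff, Set.mem_inter_iff]
    split_ifs <;> simp_all
  have e2 : ∀ ω, ∫ z, (X i ⁻¹' {x}).indicator (fun _ => if z = y then (1 : ℝ) else 0) ω ∂κ (X i ω) =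
      (X i ⁻¹' {x}).indicator (fun _ => (κ x).real {y}) ω := fun ω => by
    by_cases hω : X i ω = x
    · have : ∀ z, (if z = y then (1 : ℝ) else 0) = ({y} : Set E).indicator 1 z := fun z => by
        simp [Set.indicator]
      simp only [Set.indicator, Set.mem_preimage, Set.mem_singleton_iff, hω, if_true]
      simp_rw [this]
      rw [integral_indicator_one (measurableSet_singleton y)]
    · simp [Set.indicator, hω]
  simp_rw [e1, e2] at h
  rw [integral_indicator_one (hmx.inter hmy), integral_indicator_const _ hmx, smul_eq_mul] at h
  rw [Measure.map_apply ((hX.measurable i).prodMk (hX.measurable _)) (measurableSet_singleton _),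
    ← hX.map_eq i, Measure.map_apply (hX.measurable i) (measurableSet_singleton x)]
  have e3 : (fun ω => (X i ω, X (i + 1) ω)) ⁻¹' {(x, y)} = X i ⁻¹' {x} ∩ X (i + 1) ⁻¹' {y} := by
    ext ω; simp
  rw [e3, ← ENNReal.toReal_eq_toReal_iff' (measure_ne_top _ _)
    (ENNReal.mul_ne_top (measure_ne_top _ _) (measure_ne_top _ _)), ENNReal.toReal_mul]
  exact h

lemma IsStationaryMarkovChain.lintegral_pair (hX : IsStationaryMarkovChain κ ν P X) (i : ℤ)
    (φ : E → E → ℝ≥0∞) :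
    ∫⁻ ω, φ (X i ω) (X (i + 1) ω) ∂P = ∑' x, ∑' y, ν {x} * κ x {y} * φ x y := by
  have h := lintegral_map (μ := P) (f := fun q : E × E => φ q.1 q.2) .of_discrete
    ((hX.measurable i).prodMk (hX.measurable (i + 1)))
  rw [← h, lintegral_countable', ENNReal.tsum_prod']
  refine tsum_congr fun x => tsum_congr fun y => ?_
  rw [hX.measure_pair i x y, mul_comm]

/-- The martingale `i ↦ E[g (X_1, …, X_n) | F_{-∞}^i]`. -/
def condMartingale (X : ℤ → Ω → E) {n : ℕ} (Q : E → Measure (ℕ → E)) (g : (Fin n → E) → ℝ) (i : ℤ)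
    (ω : Ω) : ℝ := condMean Q g i (block X n ω) (X i ω)

section condMartingale

variable {n : ℕ} {g : (Fin n → E) → ℝ} {Q : E → Measure (ℕ → E)}

omit [MeasurableSpace Ω] [Countable E] [DiscreteMeasurableSpace E] [IsMarkovKernel κ] in
lemma abs_condMartingale_le (hQ : ∀ x, IsChainLaw κ x (Q x)) (hg : ∀ b, |g b| ≤ 1) (i : ℤ) (ω : Ω) :
    |condMartingale X Q g i ω| ≤ 1 :=
  abs_condMean_le (fun x => (hQ x).prob) hg _ _ _

omit [MeasurableSpace Ω] in
lemma condMartingale_eq_integral (hQ : ∀ x, IsChainLaw κ x (Q x)) (hg : ∀ b, |g b| ≤ 1) (i : ℤ)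
    (ω : Ω) :
    condMartingale X Q g i ω = ∫ z, condMean Q g (i + 1) (block X n ω) z ∂κ (X i ω) :=
  condMean_eq_integral hQ hg fun k hk => by rw [← hk]; rfl

omit [MeasurableSpace Ω] in
lemma measurable_condMartingale (i : ℤ) :
    Measurable[pastSigma X i] (condMartingale X Q g i) :=
  measurable_condMean_block (fun _ hj => measurable_pastSigma hj.le) (measurable_pastSigma le_rfl)

/-- The martingale property, tested against bounded past-measurable variables; this is the only form
in which it is used. -/
lemma IsStationaryMarkovChain.integral_mul_condMartingale (hX : IsStationaryMarkovChain κ ν P X)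
    (hQ : ∀ x, IsChainLaw κ x (Q x)) (hg : ∀ b, |g b| ≤ 1) {i : ℤ} {Z : Ω → ℝ}
    (hZ : Measurable[pastSigma X i] Z) {B : ℝ} (hB : ∀ ω, |Z ω| ≤ B) :
    ∫ ω, Z ω * condMartingale X Q g (i + 1) ω ∂P = ∫ ω, Z ω * condMartingale X Q g i ω ∂P := by
  have h := hX.integral_next (i := i)
    (F := fun ω z => Z ω * condMean Q g (i + 1) (block X n ω) z) (B := B)
    (fun z => hZ.mul (measurable_pastSigma_condMean i z)) (fun ω z => by
      rw [abs_mul]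
      exact (mul_le_of_le_one_right (abs_nonneg _)
        (abs_condMean_le (fun x => (hQ x).prob) hg _ _ _)).trans (hB ω))
  simp_rw [integral_const_mul, ← condMartingale_eq_integral hQ hg] at h
  exact h

end condMartingale

end

/-! ### Bounding the increments and summing them -/

section

/-- The weights `(m + 1)^{-(1 + η)}` summing to `ζ(1 + η)`. -/
def zetaWeight (η : ℝ) (m : ℕ) : ℝ≥0∞ := ENNReal.ofReal (1 / ((m : ℝ) + 1) ^ (1 + η))

lemma zetaWeight_eq {η : ℝ} (hη : 0 ≤ η) (m : ℕ) :
    zetaWeight η m = (((m : ℝ≥0∞) + 1) ^ ((1 + η) / 2))⁻¹ ^ 2 := by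
  have h : ((m : ℝ≥0∞) + 1) = ENNReal.ofReal ((m : ℝ) + 1) := by
    rw [ENNReal.ofReal_add (by positivity) zero_le_one]; simp
  rw [zetaWeight, one_div, ENNReal.ofReal_inv_of_pos (by positivity), ← ENNReal.inv_pow,
    ← ENNReal.rpow_natCast, ← ENNReal.rpow_mul, h, ENNReal.ofReal_rpow_of_nonneg (by positivity)
      (by positivity)]
  congr 3
  push_cast; ring

/-- `n⁻² ∑_{k ≥ i} (k - i + 1)^{-(1 + η)}`, the variance proxy of the `i`-th increment. -/
def varProxy (η : ℝ) (n : ℕ) (i : ℤ) : ℝ≥0∞ :=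
  ∑ k ∈ Finset.univ.filter (fun k : Fin n => i + 1 ≤ (k : ℤ) + 1),
    (n : ℝ≥0∞)⁻¹ ^ 2 * zetaWeight η ((k : ℤ) + 1 - (i + 1)).toNat

lemma varProxy_ne_top (η : ℝ) {n : ℕ} (hn : n ≠ 0) (i : ℤ) : varProxy η n i ≠ ⊤ :=
  ENNReal.sum_ne_top.2 fun k _ => ENNReal.mul_ne_top
    (ENNReal.pow_ne_top (ENNReal.inv_ne_top.2 (by simpa using hn))) ENNReal.ofReal_ne_top

lemma sum_comp_le_tsum {ι : Type*} (s : Finset ι) (φ : ι → ℕ) (hφ : Set.InjOn φ s)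
    (a : ℕ → ℝ≥0∞) : ∑ i ∈ s, a (φ i) ≤ ∑' m, a m := by
  rw [← Finset.sum_image (f := a) hφ]
  exact ENNReal.sum_le_tsum _

/-- For a fixed position k the lags to the different times are distinct, so their weights sum to at
most ζ(1+η); there are n positions, each with factor n⁻². The bound is uniform in the starting time
and in J, as needed for going back to -∞. -/
lemma sum_varProxy_le (η : ℝ) {n : ℕ} (hn : n ≠ 0) (i : ℤ) (J : ℕ) :
    ∑ j ∈ Finset.range J, varProxy η n (i + j) ≤ zetaSum (1 + η) / n := by
  simp only [varProxy, Finset.sum_filter]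
  rw [Finset.sum_comm]
  have h : ∀ k : Fin n, ∑ j ∈ Finset.range J, (if i + (j : ℤ) + 1 ≤ (k : ℤ) + 1 then
      (n : ℝ≥0∞)⁻¹ ^ 2 * zetaWeight η ((k : ℤ) + 1 - (i + j + 1)).toNat else 0) ≤
      (n : ℝ≥0∞)⁻¹ ^ 2 * zetaSum (1 + η) := by
    intro k
    rw [← Finset.sum_filter, ← Finset.mul_sum]
    refine mul_le_mul_right (sum_comp_le_tsum _ (fun j : ℕ => ((k : ℤ) + 1 - (i + j + 1)).toNat) ?_ _) _
    intro j hj j' hj' hjj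
    have h1 := (Finset.mem_filter.1 hj).2
    have h2 := (Finset.mem_filter.1 hj').2
    simp only at hjj
    omega
  refine (Finset.sum_le_sum fun k _ => h k).trans_eq ?_
  rw [Finset.sum_const, Finset.card_univ, Fintype.card_fin, nsmul_eq_mul, sq, ← mul_assoc,
    ← mul_assoc, ENNReal.mul_inv_cancel (by simpa using hn) (by simp), one_mul, mul_comm,
    div_eq_mul_inv]

variable {E : Type*} [MeasurableSpace E]

/-- The law of the pair of paths started from `y` and from a `κ x`-distributed point. -/
def stepCoupling (κ : Kernel E E) (Phat : E → E → Measure (ℕ → E × E)) (x y : E) :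
    Measure (ℕ → E × E) := (κ x).bind (Phat y)

/-- `∑_{x,y} ν(x) κ(x,y) (∑_z κ(x,z) Ê_{y,z}[(T+1)^{1+η/2}])^{2p}`. -/
def couplingMoment (κ : Kernel E E) (ν : Measure E) (Phat : E → E → Measure (ℕ → E × E)) (η : ℝ)
    (p : ℕ) : ℝ≥0∞ :=
  ∑' x : E, ∑' y : E, ν {x} * κ x {y} *
    (∑' z : E, κ x {z} * ∫⁻ w, (couplingTime w + 1) ^ (1 + η / 2) ∂(Phat y z)) ^ (2 * p)

lemma momentConst_eq (κ : Kernel E E) (ν : Measure E) (Phat : E → E → Measure (ℕ → E × E)) (η : ℝ)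
    (p : ℕ) : momentConst κ ν Phat η p = ENNReal.ofReal (2 * (p : ℝ) - 1) ^ (2 * p) *
      (zetaSum (1 + η) / 2) ^ p * couplingMoment κ ν Phat η p := rfl

lemma couplingMoment_ne_top {κ : Kernel E E} {ν : Measure E}
    {Phat : E → E → Measure (ℕ → E × E)} {η : ℝ} {p : ℕ} (hp : 1 ≤ p)
    (hC : momentConst κ ν Phat η p ≠ ⊤) : couplingMoment κ ν Phat η p ≠ ⊤ := by
  intro h
  rw [momentConst_eq, h, ENNReal.mul_top] at hC
  · exact hC rfl
  · have hp' : (1 : ℝ) ≤ p := by exact_mod_cast hp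
    refine mul_ne_zero (pow_ne_zero _ ?_) (pow_ne_zero _ ?_)
    · simpa using by linarith
    · simpa [ENNReal.div_eq_zero_iff] using (zero_lt_one.trans_le (one_le_zetaSum (1 + η))).ne'

variable [DiscreteMeasurableSpace E]

lemma lintegral_stepCoupling (κ : Kernel E E) (Phat : E → E → Measure (ℕ → E × E)) (x y : E)
    {φ : (ℕ → E × E) → ℝ≥0∞} (hφ : Measurable φ) :
    ∫⁻ w, φ w ∂stepCoupling κ Phat x y = ∫⁻ z, ∫⁻ w, φ w ∂Phat y z ∂κ x :=
  Measure.lintegral_bind Measurable.of_discrete.aemeasurable hφ.aemeasurable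

variable [Countable E]

lemma sq_sum_stepCoupling_le {η : ℝ} (hη : 0 ≤ η) (n : ℕ) (i : ℤ) (κ : Kernel E E)
    (Phat : E → E → Measure (ℕ → E × E)) (x y : E) :
    (∑ k ∈ Finset.univ.filter (fun k : Fin n => i + 1 ≤ (k : ℤ) + 1),
      (n : ℝ≥0∞)⁻¹ * ∫⁻ w, disagree ((k : ℤ) + 1 - (i + 1)).toNat w ∂stepCoupling κ Phat x y) ^ 2 ≤
    varProxy η n i * ((∑' z : E, κ x {z} *
      ∫⁻ w, (couplingTime w + 1) ^ (1 + η / 2) ∂(Phat y z)) ^ 2 / 2) := by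
  set μ := stepCoupling κ Phat x y with hμ
  have hW : ∑' z : E, κ x {z} * ∫⁻ w, (couplingTime w + 1) ^ (1 + η / 2) ∂(Phat y z) =
      ∫⁻ w, (couplingTime w + 1) ^ (1 + η / 2) ∂μ := by
    rw [hμ, lintegral_stepCoupling _ _ _ _ (by fun_prop), lintegral_countable']
    simp_rw [mul_comm]
  rw [hW]
  -- Cauchy–Schwarz after inserting r⁻¹ r: the squares of r⁻¹ are the zeta weights, those of r the
  -- weights in the bound by the coupling time.
  let r : ℕ → ℝ≥0∞ := fun m => ((m : ℝ≥0∞) + 1) ^ ((1 + η) / 2)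
  have hr0 : ∀ m, r m ≠ 0 := fun m => by
    simp only [r, ne_eq, ENNReal.rpow_eq_zero_iff, not_or, not_and]
    exact ⟨by simp, by simp⟩
  have hrtop : ∀ m, r m ≠ ⊤ := fun m =>
    ENNReal.rpow_ne_top_of_nonneg (by positivity) (by simp)
  have hr2 : ∀ m, r m ^ 2 = ((m : ℝ≥0∞) + 1) ^ (1 + η) := fun m => by
    simp only [r]
    rw [← ENNReal.rpow_natCast, ← ENNReal.rpow_mul]
    congr 1
    push_cast; ring
  have hsplit : ∀ m, (n : ℝ≥0∞)⁻¹ * ∫⁻ w, disagree m w ∂μ =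
      ((n : ℝ≥0∞)⁻¹ * (r m)⁻¹) * (r m * ∫⁻ w, disagree m w ∂μ) := fun m => by
    rw [mul_assoc, ← mul_assoc (r m)⁻¹, ENNReal.inv_mul_cancel (hr0 m) (hrtop m), one_mul]
  simp_rw [hsplit]
  refine (sq_sum_mul_le_sum_sq_mul _ _ _).trans (mul_le_mul' (le_of_eq ?_) ?_)
  · exact Finset.sum_congr rfl fun k _ => by rw [mul_pow, zetaWeight_eq hη]
  · simp_rw [mul_pow, hr2]
    refine le_trans (sum_comp_le_tsum _ (fun k : Fin n => ((k : ℤ) + 1 - (i + 1)).toNat) ?_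
      (fun m => ((m : ℝ≥0∞) + 1) ^ (1 + η) * (∫⁻ w, disagree m w ∂μ) ^ 2))
      (tsum_sq_lintegral_disagree_le hη μ)
    intro k hk k' hk' hkk
    have h1 := (Finset.mem_filter.1 hk).2
    have h2 := (Finset.mem_filter.1 hk').2
    simp only at hkk
    exact Fin.ext (by omega)

variable {Ω : Type*} {X : ℤ → Ω → E} {κ : Kernel E E} [IsMarkovKernel κ]
  {n : ℕ} {g : (Fin n → E) → ℝ} {Q : E → Measure (ℕ → E)} {Phat : E → E → Measure (ℕ → E × E)}

lemma enorm_condMartingale_sub_le (hPhat : ∀ x y, IsCoupling κ x y (Phat x y))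
    (hQ : ∀ x, IsChainLaw κ x (Q x)) (hg : ∀ b, |g b| ≤ 1)
    (hlip : ∀ a b, |g a - g b| ≤ normHamming a b) (i : ℤ) (ω : Ω) :
    ‖condMartingale X Q g (i + 1) ω - condMartingale X Q g i ω‖ₑ ≤
      ∑ k ∈ Finset.univ.filter (fun k : Fin n => i + 1 ≤ (k : ℤ) + 1),
        (n : ℝ≥0∞)⁻¹ * ∫⁻ w, disagree ((k : ℤ) + 1 - (i + 1)).toNat w
          ∂stepCoupling κ Phat (X i ω) (X (i + 1) ω) := by
  have hprob := fun x => (hQ x).prob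
  rw [condMartingale_eq_integral hQ hg i ω]
  set b := block X n ω
  set y := X (i + 1) ω
  have hi : Integrable (fun z => condMean Q g (i + 1) b z) (κ (X i ω)) :=
    integrable_of_abs_le .of_discrete fun z => abs_condMean_le hprob hg _ _ _
  have h1 : condMartingale X Q g (i + 1) ω - ∫ z, condMean Q g (i + 1) b z ∂κ (X i ω) =
      ∫ z, (condMean Q g (i + 1) b y - condMean Q g (i + 1) b z) ∂κ (X i ω) := by
    rw [integral_sub (integrable_const _) hi]
    simp [condMartingale, b, y]
  rw [h1]
  refine (enorm_integral_le_lintegral_enorm _).trans ?_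
  refine (lintegral_mono fun z => enorm_condMean_sub_le hPhat hQ hg hlip (i + 1) b y z).trans_eq ?_
  rw [lintegral_finsetSum _ fun k _ => .of_discrete]
  refine Finset.sum_congr rfl fun k _ => ?_
  rw [lintegral_const_mul _ .of_discrete, lintegral_stepCoupling _ _ _ _ (by fun_prop)]

variable [MeasurableSpace Ω] {P : Measure Ω} [IsProbabilityMeasure P] {ν : Measure E}

lemma IsStationaryMarkovChain.lintegral_condMartingale_sub_le (hX : IsStationaryMarkovChain κ ν P X)
    (hPhat : ∀ x y, IsCoupling κ x y (Phat x y))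
    (hQ : ∀ x, IsChainLaw κ x (Q x)) (hg : ∀ b, |g b| ≤ 1)
    (hlip : ∀ a b, |g a - g b| ≤ normHamming a b) {η : ℝ} (hη : 0 ≤ η) (p : ℕ) (i : ℤ) :
    ∫⁻ ω, ‖condMartingale X Q g (i + 1) ω - condMartingale X Q g i ω‖ₑ ^ (2 * p) ∂P ≤
      (varProxy η n i / 2) ^ p * couplingMoment κ ν Phat η p := by
  let W : E → E → ℝ≥0∞ := fun x y => ∑' z : E, κ x {z} *
      ∫⁻ w, (couplingTime w + 1) ^ (1 + η / 2) ∂(Phat y z)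
  have h : ∀ ω, ‖condMartingale X Q g (i + 1) ω - condMartingale X Q g i ω‖ₑ ^ (2 * p) ≤
      (varProxy η n i / 2) ^ p * W (X i ω) (X (i + 1) ω) ^ (2 * p) := by
    intro ω
    have h1 := (pow_le_pow_left' (enorm_condMartingale_sub_le (X := X) hPhat hQ hg hlip i ω) 2).trans
      (sq_sum_stepCoupling_le hη n i κ Phat (X i ω) (X (i + 1) ω))
    have h2 := pow_le_pow_left' h1 p
    rw [← pow_mul] at h2
    refine h2.trans_eq ?_
    change (varProxy η n i * (W (X i ω) (X (i + 1) ω) ^ 2 / 2)) ^ p = _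
    rw [pow_mul (W _ _), ← mul_pow, ← mul_div_assoc, ENNReal.mul_div_right_comm]
  refine (lintegral_mono h).trans_eq ?_
  have hm : Measurable fun ω => W (X i ω) (X (i + 1) ω) ^ (2 * p) :=
    (Measurable.of_discrete (f := fun q : E × E => W q.1 q.2 ^ (2 * p))).comp
      ((hX.measurable i).prodMk (hX.measurable (i + 1)))
  rw [lintegral_const_mul _ hm, hX.lintegral_pair i fun x y => W x y ^ (2 * p)]
  rfl

lemma IsStationaryMarkovChain.lintegral_condMartingale_sub_pow_le
    (hX : IsStationaryMarkovChain κ ν P X) (hPhat : ∀ x y, IsCoupling κ x y (Phat x y))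
    (hQ : ∀ x, IsChainLaw κ x (Q x)) (hg : ∀ b, |g b| ≤ 1)
    (hlip : ∀ a b, |g a - g b| ≤ normHamming a b) {η : ℝ} (hη : 0 ≤ η) {p : ℕ} (hp : 1 ≤ p)
    (hn : n ≠ 0) (hC : momentConst κ ν Phat η p ≠ ⊤) (i : ℤ) (J : ℕ) :
    ∫⁻ ω, ‖condMartingale X Q g (i + J) ω - condMartingale X Q g i ω‖ₑ ^ (2 * p) ∂P ≤
      momentConst κ ν Phat η p / n ^ p := by
  have hp' : (1 : ℝ) ≤ p := by exact_mod_cast hp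
  have hp0 : (p : ℝ) ≠ 0 := by positivity
  set K := couplingMoment κ ν Phat η p with hK
  have hKtop : K ≠ ⊤ := couplingMoment_ne_top hp hC
  have hKp : (K ^ (1 / (p : ℝ))) ^ p = K := by
    rw [← ENNReal.rpow_natCast, ← ENNReal.rpow_mul, one_div, inv_mul_cancel₀ hp0, ENNReal.rpow_one]
  -- The p-th root of the increment bound, i.e. a bound for the squared L^{2p} norm; K does not
  -- depend on the time, by stationarity.
  let s : ℕ → ℝ≥0∞ := fun j => varProxy η n (i + j) / 2 * K ^ (1 / (p : ℝ))
  have hs : ∀ j, s j ≠ ⊤ := fun j => ENNReal.mul_ne_top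
    (ENNReal.div_ne_top (varProxy_ne_top η hn _) (by simp))
    (ENNReal.rpow_ne_top_of_nonneg (by positivity) hKtop)
  have hmeas : ∀ j, Measurable[pastSigma X j] (condMartingale X Q g j) := measurable_condMartingale
  have hbound := abs_condMartingale_le (X := X) hQ hg
  have h := lintegral_enorm_sub_pow_le (P := P) (f := fun j : ℕ => condMartingale X Q g (i + j))
    (fun j => (hmeas _).mono (hX.pastSigma_le _) le_rfl) (B := 1) (fun j ω => hbound _ ω) hp
    (fun j => by
      simp only [Nat.cast_zero, add_zero, Nat.cast_add, Nat.cast_one, ← add_assoc]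
      have hZ : Measurable[pastSigma X (i + j)]
          fun ω => (condMartingale X Q g (i + j) ω - condMartingale X Q g i ω) ^ (2 * p - 1) :=
        ((hmeas _).sub ((hmeas i).mono (pastSigma_mono (by omega)) le_rfl)).pow_const _
      have hZb : ∀ ω, |(condMartingale X Q g (i + j) ω - condMartingale X Q g i ω) ^ (2 * p - 1)| ≤
          2 ^ (2 * p - 1) := fun ω => by
        rw [abs_pow]
        refine pow_le_pow_left₀ (abs_nonneg _) ?_ _
        have := (abs_sub _ _).trans (add_le_add (hbound (i + j) ω) (hbound i ω))
        linarith
      have hint : ∀ k, Integrable (fun ω => (condMartingale X Q g (i + j) ω -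
          condMartingale X Q g i ω) ^ (2 * p - 1) * condMartingale X Q g k ω) P := fun k =>
        integrable_of_abs_le ((hZ.mono (hX.pastSigma_le _) le_rfl).mul
          ((hmeas k).mono (hX.pastSigma_le _) le_rfl)) fun ω => by
            rw [abs_mul]
            exact mul_le_mul (hZb ω) (hbound k ω) (abs_nonneg _) (by positivity)
      simp_rw [mul_sub]
      rw [integral_sub (hint _) (hint _), sub_eq_zero]
      exact hX.integral_mul_condMartingale hQ hg hZ hZb)
    (s := fun j => (s j).toReal) (fun j => ENNReal.toReal_nonneg)
    (fun j => by
      rw [← ENNReal.toReal_pow, ENNReal.ofReal_toReal (ENNReal.pow_ne_top (hs j))]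
      have := hX.lintegral_condMartingale_sub_le hPhat hQ hg hlip hη p (i + j)
      simp only [Nat.cast_add, Nat.cast_one, ← add_assoc]
      rwa [mul_pow, hKp]) J
  simp only [Nat.cast_zero, add_zero] at h
  refine h.trans ?_
  have h2p : (0 : ℝ) ≤ 2 * p - 1 := by linarith
  rw [← ENNReal.toReal_sum fun j _ => hs j, ENNReal.ofReal_pow
    (mul_nonneg (sq_nonneg _) ENNReal.toReal_nonneg), ENNReal.ofReal_mul (sq_nonneg _),
    ENNReal.ofReal_toReal (ENNReal.sum_ne_top.2 fun j _ => hs j), ENNReal.ofReal_pow h2p, mul_pow,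
    ← pow_mul, momentConst_eq]
  have hsum : ∑ j ∈ Finset.range J, s j ≤ zetaSum (1 + η) / 2 / n * K ^ (1 / (p : ℝ)) := by
    simp only [s, ← Finset.sum_mul, div_eq_mul_inv (varProxy _ _ _)]
    refine mul_le_mul_left ?_ _
    refine (mul_le_mul_left (sum_varProxy_le η hn i J) _).trans_eq ?_
    simp only [div_eq_mul_inv]
    ring
  refine (mul_le_mul_right (pow_le_pow_left' hsum p) _).trans_eq ?_
  rw [mul_pow, hKp, div_eq_mul_inv _ (n : ℝ≥0∞), mul_pow, ← ENNReal.inv_pow, div_eq_mul_inv _ (n ^ p : ℝ≥0∞)]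
  ring

end

/-! ### Tail triviality: the martingale tends to the mean at -∞ -/

section

variable {Ω E : Type*} [MeasurableSpace Ω] [MeasurableSpace E] {X : ℤ → Ω → E} {P : Measure Ω}
  [IsProbabilityMeasure P]

open Filter Topology

/-- Bounded sequences whose successive `L²` distances decay geometrically converge almost surely. -/
lemma ae_cauchySeq_of_integral_sq_le {f : ℕ → Ω → ℝ} (hf : ∀ k, Measurable (f k)) {B : ℝ}
    (hB : ∀ k ω, |f k ω| ≤ B)
    (h : ∀ k, ∫ ω, (f k ω - f (k + 1) ω) ^ 2 ∂P ≤ (1 / 4) ^ k) :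
    ∀ᵐ ω ∂P, CauchySeq fun k => f k ω := by
  have hd : ∀ k ω, |f k ω - f (k + 1) ω| ≤ B + B := fun k ω =>
    (abs_sub _ _).trans (add_le_add (hB _ ω) (hB _ ω))
  have hdm : ∀ k, Measurable fun ω => f k ω - f (k + 1) ω := fun k => (hf _).sub (hf _)
  have h1 : ∀ k, ∫⁻ ω, ‖f k ω - f (k + 1) ω‖ₑ ∂P ≤ ENNReal.ofReal (2 * (1 / 2) ^ k) := by
    intro k
    have hi : Integrable (fun ω => f k ω - f (k + 1) ω) P := integrable_of_abs_le (hdm k) (hd k)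
    have hi2 : Integrable (fun ω => (f k ω - f (k + 1) ω) ^ 2) P :=
      integrable_of_abs_le ((hdm k).pow_const 2) (B := (B + B) ^ 2) fun ω => by
        rw [abs_pow]; exact pow_le_pow_left₀ (abs_nonneg _) (hd k ω) 2
    rw [← ofReal_integral_norm_eq_lintegral_enorm hi]
    refine ENNReal.ofReal_le_ofReal ?_
    calc ∫ ω, ‖f k ω - f (k + 1) ω‖ ∂P
        -- AM–GM, with weight 2^k chosen to balance the assumed decay 4^{-k}; the resulting L¹ norms
        -- are summable.
        ≤ ∫ ω, ((1 / 2) ^ k + 2 ^ k * (f k ω - f (k + 1) ω) ^ 2) ∂P := by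
          refine integral_mono hi.norm ((integrable_const _).add (hi2.const_mul _)) fun ω => ?_
          have h2 : (0 : ℝ) < 2 ^ k := by positivity
          have h3 : ((1 : ℝ) / 2) ^ k = (2 ^ k)⁻¹ := by rw [one_div, inv_pow]
          simp only [h3, Real.norm_eq_abs]
          rw [← sq_abs]
          set x := |f k ω - f (k + 1) ω|
          have h4 : 0 ≤ 2 ^ k * (x - (2 ^ k)⁻¹) ^ 2 := by positivity
          have h5 : (2 : ℝ) ^ k * (x - (2 ^ k)⁻¹) ^ 2 = 2 ^ k * x ^ 2 - 2 * x + (2 ^ k)⁻¹ := by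
            field_simp
            ring
          have : 0 ≤ x := abs_nonneg _
          linarith
      _ = (1 / 2) ^ k + 2 ^ k * ∫ ω, (f k ω - f (k + 1) ω) ^ 2 ∂P := by
          rw [integral_add (integrable_const _) (hi2.const_mul _), integral_const_mul]; simp
      _ ≤ (1 / 2) ^ k + 2 ^ k * (1 / 4) ^ k := by gcongr; exact h k
      _ = 2 * (1 / 2) ^ k := by rw [← mul_pow]; norm_num; ring
  have h2 : ∫⁻ ω, ∑' k, ‖f k ω - f (k + 1) ω‖ₑ ∂P ≠ ⊤ := by
    rw [lintegral_tsum fun k => (hdm k).enorm.aemeasurable]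
    refine ne_top_of_le_ne_top ?_ (ENNReal.tsum_le_tsum h1)
    exact ((summable_geometric_of_lt_one (by norm_num) (by norm_num)).mul_left 2).tsum_ofReal_ne_top
  have h3 := ae_lt_top (Measurable.tsum fun k => (hdm k).enorm) h2
  filter_upwards [h3] with ω hω
  refine cauchySeq_of_edist_le_of_tsum_ne_top (fun k => ‖f k ω - f (k + 1) ω‖ₑ) (fun k => ?_) hω.ne
  rw [edist_eq_enorm_sub]

lemma ae_eq_const_of_isTailTrivial (hle : ∀ i, pastSigma X i ≤ ‹MeasurableSpace Ω›)
    (htail : IsTailTrivial P X) {h : Ω → ℝ} (hh : ∀ i, Measurable[pastSigma X i] h) :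
    ∃ c, h =ᵐ[P] fun _ => c := by
  refine exists_eventuallyEq_const_of_forall_separating MeasurableSet fun U hU => ?_
  have hm : MeasurableSet (h ⁻¹' U) := hle 0 _ (hh 0 hU)
  have := htail (h ⁻¹' U) (MeasurableSpace.measurableSet_iInf.2 fun i => hh i hU)
  rcases this with h0 | h1
  · exact Or.inr (measure_eq_zero_iff_ae_notMem.1 h0)
  · exact Or.inl ((prob_compl_eq_zero_iff hm).2 h1)

variable [Countable E] [DiscreteMeasurableSpace E] {κ : Kernel E E} [IsMarkovKernel κ]
  {ν : Measure E} {n : ℕ} {g : (Fin n → E) → ℝ} {Q : E → Measure (ℕ → E)}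

lemma IsStationaryMarkovChain.integral_mul_condMartingale_add (hX : IsStationaryMarkovChain κ ν P X)
    (hQ : ∀ x, IsChainLaw κ x (Q x)) (hg : ∀ b, |g b| ≤ 1) {i : ℤ} {Z : Ω → ℝ}
    (hZ : Measurable[pastSigma X i] Z) {B : ℝ} (hB : ∀ ω, |Z ω| ≤ B) (J : ℕ) :
    ∫ ω, Z ω * condMartingale X Q g (i + J) ω ∂P = ∫ ω, Z ω * condMartingale X Q g i ω ∂P := by
  induction J with
  | zero => simp
  | succ J ih =>
    have := hX.integral_mul_condMartingale (i := i + J) hQ hg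
      (hZ.mono (pastSigma_mono (by omega)) le_rfl) hB
    rw [← ih, ← this]
    push_cast
    simp only [add_assoc]

lemma IsStationaryMarkovChain.exists_tendsto_condMartingale (hX : IsStationaryMarkovChain κ ν P X)
    (htail : IsTailTrivial P X) (hQ : ∀ x, IsChainLaw κ x (Q x)) (hg : ∀ b, |g b| ≤ 1) :
    ∃ φ : ℕ → ℕ, ∀ᵐ ω ∂P, Tendsto (fun k => condMartingale X Q g (-(φ k : ℤ)) ω) atTop
      (𝓝 (∫ ω, g (block X n ω) ∂P)) := by
  let h : ℕ → Ω → ℝ := fun N => condMartingale X Q g (-(N : ℤ))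
  have hpm : ∀ N : ℕ, Measurable[pastSigma X (-(N : ℤ))] (h N) := fun N => measurable_condMartingale _
  have hm : ∀ N, Measurable (h N) := fun N => (hpm N).mono (hX.pastSigma_le _) le_rfl
  have hb : ∀ N ω, |h N ω| ≤ 1 := fun N ω => abs_condMartingale_le hQ hg _ ω
  have hii : ∀ N M, Integrable (fun ω => h N ω * h M ω) P := fun N M =>
    integrable_of_abs_le ((hm N).mul (hm M)) (B := 1) fun ω => by
      rw [abs_mul]; exact mul_le_one₀ (hb N ω) (abs_nonneg _) (hb M ω)
  let I : ℕ → ℝ := fun N => ∫ ω, h N ω * h N ω ∂P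
  -- Orthogonality of martingale increments: squared L² distances are differences of the second
  -- moments I. These decrease to a limit, so a subsequence with geometrically small gaps exists.
  have hcross : ∀ N d, ∫ ω, h (N + d) ω * h N ω ∂P = I (N + d) := fun N d => by
    have := hX.integral_mul_condMartingale_add hQ hg (hpm (N + d)) (hb (N + d)) d
    have e : (-((N + d : ℕ) : ℤ) + d) = -(N : ℤ) := by push_cast; ring
    rwa [e] at this
  have hdist : ∀ N d, ∫ ω, (h N ω - h (N + d) ω) ^ 2 ∂P = I N - I (N + d) := fun N d => by
    have e : ∀ ω, (h N ω - h (N + d) ω) ^ 2 =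
        h N ω * h N ω + h (N + d) ω * h (N + d) ω - 2 * (h (N + d) ω * h N ω) := fun ω => by ring
    simp_rw [e]
    rw [integral_sub (f := fun ω => h N ω * h N ω + h (N + d) ω * h (N + d) ω)
        ((hii _ _).add (hii _ _)) ((hii _ _).const_mul 2),
      integral_add (hii _ _) (hii _ _), integral_const_mul, hcross]
    simp only [I]; ring
  have hanti : Antitone I := antitone_nat_of_succ_le fun N => by
    have := hdist N 1
    have h0 : 0 ≤ ∫ ω, (h N ω - h (N + 1) ω) ^ 2 ∂P := integral_nonneg fun ω => sq_nonneg _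
    linarith
  have hI0 : ∀ N, 0 ≤ I N := fun N => integral_nonneg fun ω => mul_self_nonneg _
  have hbdd : BddBelow (Set.range I) := ⟨0, by rintro _ ⟨N, rfl⟩; exact hI0 N⟩
  have hlim := tendsto_atTop_ciInf hanti hbdd
  have hge : ∀ N, ⨅ N, I N ≤ I N := fun N => ciInf_le hbdd N
  have hev : ∀ k : ℕ, ∀ᶠ N in atTop, I N - (⨅ N, I N) ≤ (1 / 4) ^ k := fun k => by
    have h1 : ∀ᶠ N in atTop, I N < (⨅ N, I N) + (1 / 4) ^ k :=
      hlim.eventually_lt_const (lt_add_of_pos_right _ (by positivity))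
    exact h1.mono fun N hN => by linarith
  obtain ⟨φ, hφ, hφI⟩ := extraction_forall_of_eventually hev
  have hcauchy := ae_cauchySeq_of_integral_sq_le (P := P) (f := fun k => h (φ k))
    (fun k => hm _) (fun k ω => hb _ ω) (fun k => by
      obtain ⟨d, hd⟩ := Nat.exists_eq_add_of_le (hφ (Nat.lt_succ_self k)).le
      rw [Nat.succ_eq_add_one] at hd
      rw [hd, hdist]
      linarith [hge (φ k + d), hφI k])
  let H : Ω → ℝ := fun ω => limsup (fun k => h (φ k) ω) atTop
  have hHm : ∀ i, Measurable[pastSigma X i] H := fun i => by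
    -- Dropping initial terms does not change the limsup; since φ(k) ≥ k, all remaining terms are
    -- measurable at time i.
    have e : H = fun ω => limsup (fun k => h (φ (k + (-i).toNat)) ω) atTop := by
      funext ω
      exact (limsup_nat_add (fun k => h (φ k) ω) _).symm
    rw [e]
    refine Measurable.limsup fun k => (hpm _).mono (pastSigma_mono ?_) le_rfl
    have := hφ.le_apply (x := k + (-i).toNat)
    omega
  obtain ⟨c, hc⟩ := ae_eq_const_of_isTailTrivial hX.pastSigma_le htail hHm
  have hconv : ∀ᵐ ω ∂P, Tendsto (fun k => h (φ k) ω) atTop (𝓝 c) := by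
    filter_upwards [hcauchy, hc] with ω hω hcω
    obtain ⟨l, hl⟩ := cauchySeq_tendsto_of_complete hω
    have : H ω = l := hl.limsup_eq
    rwa [← hcω, this]
  have hint : ∀ N, ∫ ω, h N ω ∂P = ∫ ω, g (block X n ω) ∂P := fun N => by
    -- N + n + 1 steps lead from -N to time n + 1, the first at which the whole block lies strictly
    -- in the past and the martingale equals g of the block.
    have := hX.integral_mul_condMartingale_add hQ hg (i := -(N : ℤ)) (Z := fun _ => 1)
      measurable_const (B := 1) (by simp) (N + (n + 1))
    simp only [one_mul] at this
    rw [← this]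
    refine integral_congr_ae (.of_forall fun ω => ?_)
    exact condMean_of_lt (fun x => (hQ x).prob) (by push_cast; omega) _ _
  have hc' : c = ∫ ω, g (block X n ω) ∂P := by
    have h1 := tendsto_integral_of_dominated_convergence (μ := P) (F := fun k => h (φ k))
      (f := fun _ => c) (fun _ => 1) (fun k => (hm _).aestronglyMeasurable) (integrable_const _)
      (fun k => .of_forall (hb _)) hconv
    simp only [hint, integral_const, probReal_univ, one_smul] at h1
    exact (tendsto_nhds_unique h1 tendsto_const_nhds)
  exact ⟨φ, hc' ▸ hconv⟩

/-- The moment bound for Lipschitz functions of the block around their mean. -/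
theorem IsStationaryMarkovChain.lintegral_sub_mean_pow_le (hX : IsStationaryMarkovChain κ ν P X)
    (htail : IsTailTrivial P X) {Phat : E → E → Measure (ℕ → E × E)}
    (hPhat : ∀ x y, IsCoupling κ x y (Phat x y)) (hg : ∀ b, |g b| ≤ 1)
    (hlip : ∀ a b, |g a - g b| ≤ normHamming a b) {η : ℝ} (hη : 0 ≤ η) {p : ℕ} (hp : 1 ≤ p)
    (hn : n ≠ 0) (hC : momentConst κ ν Phat η p ≠ ⊤) :
    ∫⁻ ω, ‖g (block X n ω) - ∫ ω, g (block X n ω) ∂P‖ₑ ^ (2 * p) ∂P ≤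
      momentConst κ ν Phat η p / n ^ p := by
  obtain ⟨Q, hQ⟩ : ∃ Q : E → Measure (ℕ → E), ∀ x, IsChainLaw κ x (Q x) :=
    ⟨_, fun x => (hPhat x x).fst⟩
  obtain ⟨φ, hφ⟩ := hX.exists_tendsto_condMartingale htail hQ hg
  have hlast : ∀ k ω, condMartingale X Q g (-(φ k : ℤ) + (φ k + (n + 1) : ℕ)) ω = g (block X n ω) :=
    fun k ω => condMean_of_lt (fun x => (hQ x).prob) (by push_cast; omega) _ _
  have hbd : ∀ k, ∫⁻ ω, ‖g (block X n ω) - condMartingale X Q g (-(φ k : ℤ)) ω‖ₑ ^ (2 * p) ∂P ≤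
      momentConst κ ν Phat η p / n ^ p := fun k => by
    have := hX.lintegral_condMartingale_sub_pow_le hPhat hQ hg hlip hη hp hn hC (-(φ k : ℤ))
      (φ k + (n + 1))
    simpa only [hlast] using this
  have hgm : Measurable fun ω => g (block X n ω) :=
    (Measurable.of_discrete (f := g)).comp (measurable_pi_iff.2 fun k => hX.measurable _)
  have hcm : ∀ k, Measurable (condMartingale X Q g (-(φ k : ℤ))) := fun k =>
    (measurable_condMartingale _).mono (hX.pastSigma_le _) le_rfl
  refine le_of_tendsto' (tendsto_lintegral_of_dominated_convergence (fun _ => 2 ^ (2 * p))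
    (fun k => ((hgm.sub (hcm k)).enorm.pow_const _)) (fun k => .of_forall fun ω => ?_)
    (by simp) ?_) hbd
  · refine pow_le_pow_left' ?_ _
    rw [← ofReal_norm, Real.norm_eq_abs, show (2 : ℝ≥0∞) = ENNReal.ofReal 2 by simp]
    refine ENNReal.ofReal_le_ofReal ((abs_sub _ _).trans ?_)
    linarith [hg (block X n ω), abs_condMartingale_le (X := X) hQ hg (-(φ k : ℤ)) ω]
  · filter_upwards [hφ] with ω hω
    exact ((ENNReal.continuous_pow _).tendsto _).comp
      ((continuous_enorm.tendsto _).comp (tendsto_const_nhds.sub hω))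

end

/-! ### The Hamming distance to a set is a bounded Lipschitz function -/

section

variable {E : Type*} {n : ℕ}

lemma normHamming_nonneg (x y : Fin n → E) : 0 ≤ normHamming x y := by
  unfold normHamming; positivity

lemma normHamming_le_one (x y : Fin n → E) : normHamming x y ≤ 1 := by
  classical
  unfold normHamming
  refine div_le_one_of_le₀ ?_ (Nat.cast_nonneg n)
  exact_mod_cast (hammingDist_le_card_fintype (x := x) (y := y)).trans_eq (Fintype.card_fin n)

lemma normHamming_triangle (x y z : Fin n → E) :
    normHamming x z ≤ normHamming x y + normHamming y z := by
  classical
  unfold normHamming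
  rw [← add_div]
  gcongr
  exact_mod_cast hammingDist_triangle x y z

lemma normHamming_comm (x y : Fin n → E) : normHamming x y = normHamming y x := by
  classical
  simp only [normHamming, hammingDist_comm]

/-- The normalized Hamming distance to a set. -/
def distTo (A : Set (Fin n → E)) (y : Fin n → E) : ℝ := ⨅ x : A, normHamming (x : Fin n → E) y

lemma bddBelow_normHamming (A : Set (Fin n → E)) (y : Fin n → E) :
    BddBelow (Set.range fun x : A => normHamming (x : Fin n → E) y) :=
  ⟨0, by rintro _ ⟨x, rfl⟩; exact normHamming_nonneg _ _⟩

lemma distTo_nonneg (A : Set (Fin n → E)) (y : Fin n → E) : 0 ≤ distTo A y :=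
  Real.iInf_nonneg fun _ => normHamming_nonneg _ _

lemma distTo_eq_zero {A : Set (Fin n → E)} {y : Fin n → E} (hy : y ∈ A) : distTo A y = 0 := by
  classical
  refine le_antisymm ((ciInf_le (bddBelow_normHamming A y) ⟨y, hy⟩).trans_eq ?_)
    (distTo_nonneg A y)
  simp [normHamming]

lemma abs_distTo_le_one {A : Set (Fin n → E)} (hA : A.Nonempty) (y : Fin n → E) :
    |distTo A y| ≤ 1 := by
  rw [abs_of_nonneg (distTo_nonneg A y)]
  obtain ⟨x, hx⟩ := hA
  exact (ciInf_le (bddBelow_normHamming A y) ⟨x, hx⟩).trans (normHamming_le_one _ _)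

lemma distTo_le_add {A : Set (Fin n → E)} (hA : A.Nonempty) (y z : Fin n → E) :
    distTo A y ≤ distTo A z + normHamming y z := by
  have := hA.to_subtype
  rw [← sub_le_iff_le_add]
  refine le_ciInf fun x => ?_
  rw [sub_le_iff_le_add, normHamming_comm y z]
  exact (ciInf_le (bddBelow_normHamming A y) x).trans (normHamming_triangle _ _ _)

lemma abs_distTo_sub_le {A : Set (Fin n → E)} (hA : A.Nonempty) (y z : Fin n → E) :
    |distTo A y - distTo A z| ≤ normHamming y z := by
  rw [abs_le]
  constructor
  · linarith [distTo_le_add hA z y, normHamming_comm y z]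
  · linarith [distTo_le_add hA y z]

end

/-! ### From moments to concentration -/

section

variable {Ω : Type*} [MeasurableSpace Ω] {P : Measure Ω} [IsProbabilityMeasure P]

/-- If `f ≥ 0` vanishes on `S` and has `2p`-th central moment at most `M`, then
`f ≤ ε` outside a set of probability `M / (ε - (M / P S)^{1/2p})^{2p}`. -/
lemma real_gt_le_of_moment_le {f : Ω → ℝ} (hf : Measurable f) (hf1 : ∀ ω, |f ω| ≤ 1) {p : ℕ}
    (hp : 1 ≤ p) {M : ℝ} (hM : ∫ ω, (f ω - ∫ ω, f ω ∂P) ^ (2 * p) ∂P ≤ M)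
    {S : Set Ω} (hS : MeasurableSet S) (hS0 : 0 < P.real S) (hfS : ∀ ω ∈ S, f ω = 0) {ε r : ℝ}
    (hr : 0 ≤ r) (hrM : M ≤ r ^ (2 * p) * P.real S) (hε : r < ε) :
    P.real {ω | ε < f ω} ≤ M / (ε - r) ^ (2 * p) := by
  set m := ∫ ω, f ω ∂P
  have hpow : ∀ x : ℝ, 0 ≤ x ^ (2 * p) := fun x => by rw [pow_mul]; positivity
  have hint : Integrable (fun ω => (f ω - m) ^ (2 * p)) P :=
    integrable_of_abs_le ((hf.sub_const m).pow_const _) (B := (1 + |m|) ^ (2 * p)) fun ω => by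
      rw [abs_pow]
      exact pow_le_pow_left₀ (abs_nonneg _) ((abs_sub _ _).trans (by linarith [hf1 ω])) _
  have hmark : ∀ (U : Set Ω), MeasurableSet U → ∀ c : ℝ, (∀ ω ∈ U, c ≤ (f ω - m) ^ (2 * p)) →
      c * P.real U ≤ M := by
    intro U hU c hc
    calc c * P.real U = ∫ _ in U, c ∂P := by simp [mul_comm]
      _ ≤ ∫ ω in U, (f ω - m) ^ (2 * p) ∂P :=
          setIntegral_mono_on (integrable_const c).integrableOn hint.integrableOn hU hc
      _ ≤ ∫ ω, (f ω - m) ^ (2 * p) ∂P :=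
          setIntegral_le_integral hint (.of_forall fun ω => hpow _)
      _ ≤ M := hM
  -- On S the deviation |f - m| equals |m|, so Markov's inequality on S bounds the mean.
  have hm : m ≤ r := by
    have h1 := hmark S hS (m ^ (2 * p)) fun ω hω => by
      rw [hfS ω hω, zero_sub, (even_two_mul p).neg_pow]
    have h2 : m ^ (2 * p) ≤ r ^ (2 * p) := le_of_mul_le_mul_right (h1.trans hrM) hS0
    by_contra hlt
    rw [not_le] at hlt
    exact absurd (pow_lt_pow_left₀ hlt hr (by omega)) (not_lt.2 h2)
  rw [le_div_iff₀ (pow_pos (by linarith) _), mul_comm]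
  refine hmark _ (measurableSet_lt measurable_const hf) _ fun ω hω => ?_
  have : ε < f ω := hω
  exact pow_le_pow_left₀ (by linarith) (by linarith) _

end

/-- Since T + 1 ≥ 1 and all weights are probabilities, the coupling moment is at least 1.
Nonvanishing makes the real division by C_p^{1/2p} in the final bound meaningful. -/
lemma momentConst_ne_zero {Ω E : Type*} [MeasurableSpace Ω] [Countable E] [MeasurableSpace E]
    [DiscreteMeasurableSpace E] {P : Measure Ω} [IsProbabilityMeasure P] {X : ℤ → Ω → E}
    {κ : Kernel E E} [IsMarkovKernel κ] {ν : Measure E} (hX : IsStationaryMarkovChain κ ν P X)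
    {Phat : E → E → Measure (ℕ → E × E)} (hPhat : ∀ x y : E, IsCoupling κ x y (Phat x y))
    {η : ℝ} (hη : 0 ≤ η) {p : ℕ} (hp : 1 ≤ p) : momentConst κ ν Phat η p ≠ 0 := by
  have hp' : (1 : ℝ) ≤ p := by exact_mod_cast hp
  have hPone : ∀ y z, 1 ≤ ∫⁻ w, (couplingTime w + 1) ^ (1 + η / 2) ∂Phat y z := fun y z => by
    have hm1 : Measurable fun (w : ℕ → E × E) k => (w k).1 := by fun_prop
    have h1 : Phat y z Set.univ = 1 := by
      have := (hPhat y z).fst.prob.measure_univ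
      rwa [Measure.map_apply hm1 .univ, Set.preimage_univ] at this
    calc (1 : ℝ≥0∞) = ∫⁻ _, 1 ∂Phat y z := by simp [h1]
      _ ≤ _ := lintegral_mono fun w => ENNReal.one_le_rpow le_add_self (by positivity)
  have hW : ∀ x y, 1 ≤ ∑' z : E, κ x {z} *
      ∫⁻ w, (couplingTime w + 1) ^ (1 + η / 2) ∂(Phat y z) := fun x y => by
    calc (1 : ℝ≥0∞) = ∑' z, κ x {z} := by
          simpa using (lintegral_countable' (μ := κ x) (fun _ => 1))
      _ ≤ _ := ENNReal.tsum_le_tsum fun z => le_mul_of_one_le_right' (hPone y z)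
  have hK : 1 ≤ couplingMoment κ ν Phat η p := by
    rw [couplingMoment, ← hX.lintegral_pair 0 fun x y => (∑' z : E, κ x {z} *
      ∫⁻ w, (couplingTime w + 1) ^ (1 + η / 2) ∂(Phat y z)) ^ (2 * p)]
    calc (1 : ℝ≥0∞) = ∫⁻ _, 1 ∂P := by simp
      _ ≤ _ := lintegral_mono fun ω => one_le_pow₀ (hW _ _)
  rw [momentConst_eq]
  refine mul_ne_zero (mul_ne_zero (pow_ne_zero _ ?_) (pow_ne_zero _ ?_))
    (zero_lt_one.trans_le hK).ne'
  · simpa using by linarith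
  · simpa [ENNReal.div_eq_zero_iff] using (zero_lt_one.trans_le (one_le_zetaSum (1 + η))).ne'

end

end HammingConcentration

open HammingConcentration in
theorem theorem5 {Ω E : Type*} [MeasurableSpace Ω]
    [Countable E] [MeasurableSpace E] [DiscreteMeasurableSpace E]
    (P : Measure Ω) [IsProbabilityMeasure P]
    (X : ℤ → Ω → E) (κ : Kernel E E) [IsMarkovKernel κ] (ν : Measure E)
    (hX : IsStationaryMarkovChain κ ν P X) (htail : IsTailTrivial P X)
    (Phat : E → E → Measure (ℕ → E × E)) (hPhat : ∀ x y : E, IsCoupling κ x y (Phat x y))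
    (η : ℝ) (hη : 0 < η)
    (n : ℕ) (hn : 1 ≤ n) (A : Set (Fin n → E)) (hA : MeasurableSet A)
    (hPA : 0 < P (block X n ⁻¹' A))
    (p : ℕ) (hp : 1 ≤ p) (ε : ℝ)
    (hε : momentConst κ ν Phat η p ^ (1 / (2 * (p : ℝ))) /
        (ENNReal.ofReal (Real.sqrt n) * P (block X n ⁻¹' A) ^ (1 / (2 * (p : ℝ))))
      < ENNReal.ofReal ε) :
    1 - 1 / (n : ℝ) ^ p *
        (1 / (ε / (momentConst κ ν Phat η p).toReal ^ (1 / (2 * (p : ℝ))) -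
            1 / (Real.sqrt n * P.real (block X n ⁻¹' A) ^ (1 / (2 * (p : ℝ))))) ^ (2 * p))
      ≤ P.real (block X n ⁻¹' hammingNhd A ε) := by
  have hp0 : (0 : ℝ) < 1 / (2 * (p : ℝ)) := by
    have : (1 : ℝ) ≤ p := by exact_mod_cast hp
    positivity
  have hn0 : (0 : ℝ) < n := by exact_mod_cast hn
  have hsn : 0 < Real.sqrt n := Real.sqrt_pos.2 hn0
  set C := momentConst κ ν Phat η p with hCdef
  have hC0 : C ≠ 0 := momentConst_ne_zero hX hPhat hη.le hp
  set S := block X n ⁻¹' A with hSdef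
  have hden : ENNReal.ofReal (Real.sqrt n) * P S ^ (1 / (2 * (p : ℝ))) ≠ ⊤ :=
    ENNReal.mul_ne_top ENNReal.ofReal_ne_top
      (ENNReal.rpow_ne_top_of_nonneg hp0.le (measure_ne_top _ _))
  have hCtop : C ≠ ⊤ := by
    intro h
    rw [h, ENNReal.top_rpow_of_pos hp0, ENNReal.top_div_of_ne_top hden] at hε
    exact not_top_lt hε
  have hbm : Measurable (block X n) := measurable_pi_iff.2 fun k => hX.measurable _
  have hSm : MeasurableSet S := hbm hA
  have hAne : A.Nonempty := by
    rw [Set.nonempty_iff_ne_empty]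
    rintro rfl
    simp [hSdef] at hPA
  have hS0 : 0 < P.real S := ENNReal.toReal_pos hPA.ne' (measure_ne_top _ _)
  have hc0 : 0 < C.toReal := ENNReal.toReal_pos hC0 hCtop
  set c := C.toReal ^ (1 / (2 * (p : ℝ))) with hc
  set s := P.real S ^ (1 / (2 * (p : ℝ))) with hs
  have hcpos : 0 < c := Real.rpow_pos_of_pos hc0 _
  have hspos : 0 < s := Real.rpow_pos_of_pos hS0 _
  have hroot : ∀ x : ℝ, 0 ≤ x → (x ^ (1 / (2 * (p : ℝ)))) ^ (2 * p) = x := fun x hx => by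
    have : (1 / (2 * (p : ℝ))) = (((2 * p : ℕ) : ℝ))⁻¹ := by push_cast; rw [one_div]
    rw [this, Real.rpow_inv_natCast_pow hx (by omega)]
  have hlt : c / (Real.sqrt n * s) < ε := by
    have h1 := (ENNReal.toReal_lt_toReal hε.ne_top ENNReal.ofReal_ne_top).2 hε
    rw [ENNReal.toReal_div, ENNReal.toReal_mul, ← ENNReal.toReal_rpow, ← ENNReal.toReal_rpow,
      ENNReal.toReal_ofReal hsn.le] at h1
    have h2 : 0 < ε := ENNReal.ofReal_pos.1 (zero_le.trans_lt hε)
    rwa [ENNReal.toReal_ofReal h2.le] at h1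
  have hgm : Measurable fun ω => distTo A (block X n ω) :=
    (Measurable.of_discrete (f := distTo A)).comp hbm
  have hmom : ∫ ω, (distTo A (block X n ω) - ∫ ω, distTo A (block X n ω) ∂P) ^ (2 * p) ∂P ≤
      C.toReal / n ^ p := by
    have h := hX.lintegral_sub_mean_pow_le htail hPhat (abs_distTo_le_one hAne)
      (abs_distTo_sub_le hAne) hη.le hp (by omega) hCtop
    rw [lintegral_enorm_pow_eq (hgm.sub_const _) (B := 1 + |∫ ω, distTo A (block X n ω) ∂P|)
      (fun ω => (abs_sub _ _).trans (by linarith [abs_distTo_le_one hAne (block X n ω)]))] at h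
    have hfin : C / (n : ℝ≥0∞) ^ p ≠ ⊤ := ENNReal.div_ne_top hCtop (by simp; omega)
    have h2 := (ENNReal.ofReal_le_iff_le_toReal hfin).1 h
    simpa using h2
  have hmain := real_gt_le_of_moment_le (f := fun ω => distTo A (block X n ω)) hgm
    (fun ω => abs_distTo_le_one hAne _) hp hmom hSm hS0 (fun ω hω => distTo_eq_zero hω)
    -- This r solves r^{2p} P(A) = C_p / n^p exactly.
    (ε := ε) (r := c / (Real.sqrt n * s)) (by positivity) (le_of_eq (by
      rw [div_pow, mul_pow, hroot _ hc0.le, hroot _ hS0.le, pow_mul, Real.sq_sqrt hn0.le]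
      field_simp)) hlt
  have hcompl : (block X n ⁻¹' hammingNhd A ε)ᶜ = {ω | ε < distTo A (block X n ω)} := by
    ext ω
    simp [hammingNhd, distTo]
  have hnm : MeasurableSet (block X n ⁻¹' hammingNhd A ε) := hbm .of_discrete
  have hsum := probReal_compl_eq_one_sub (μ := P) hnm
  rw [hcompl] at hsum
  have halg : C.toReal / n ^ p / (ε - c / (Real.sqrt n * s)) ^ (2 * p) =
      1 / (n : ℝ) ^ p * (1 / (ε / c - 1 / (Real.sqrt n * s)) ^ (2 * p)) := by
    have h1 : ε - c / (Real.sqrt n * s) = c * (ε / c - 1 / (Real.sqrt n * s)) := by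
      field_simp
    rw [h1, mul_pow, hroot _ hc0.le]
    field_simp
  rw [halg] at hmain
  linarith
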